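/- **Setting.** Let $r\ge 0$, let $\mathbf x=(x_1,\dots,x_r)$ be indeterminates, and let $D$ be a finite subset of $\mathbb C[\mathbf x,\mathbf x^{-1}]$. Fix a total order on the monomials $\mathbf x^m$ ($m\in\mathbb Z^r$) compatible with multiplication. For $z\in\mathbb C$ and $a\in\mathbb C[\mathbf x,\mathbf x^{-1}]$, the fraction $1/(z-a)$ is expanded in the field of formal Laurent series with well-ordered support, and integrals of such series are taken coefficientwise, with values in $\mathbb C[[\mathbf x,\mathbf x^{-1}]]$. A *path* on $M\subseteq\mathbb C$ is a piecewise smooth map $\gamma\colon[0,1]\to\mathbb C$ with $\gamma((0,1))\subseteq M$ that has non-zero one-sided tangent vectors $\lim_{t\searrow0}(\gamma(t)-\gamma(0))/t$ and $\lim_{t\nearrow1}(\gamma(t)-\gamma(1))/(t-1)$. Let $\gamma$ be a path on $\mathbb C\setminus(D\cup\{0\})$. Assume that for every non-constant $a\in D$ either some monomial of $a$ is smaller than $1$, or the constant term of $a$ does not lie on $\gamma([0,1])$ (so that the coefficients of $1/(\gamma(t)-a)$ have no pole along $\gamma$; this holds for $a=x_i^{-1}$ if $x_i>1$). A *$D$-colored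 rooted tree* $X=(V,E,\mathrm{rt},C)$ is a finite tree $(V,E)$ with a root $\mathrm{rt}\in V$ and a map $C\colon V\to D$. For $v\ne\mathrm{rt}$, let $p_v$ be the vertex adjacent to $v$ that is nearest to $\mathrm{rt}$. An *index* is a map $\mathbf k\colon E\to\mathbb Z_{\ge0}$; put $\mathbf k_v=\mathbf k(\{v,p_v\})$ for $v\neq\mathrm{rt}$ and $\mathbf k_{\mathrm{rt}}=1$. It is *essentially positive* if the sum of $\mathbf k$ over the path between any two distinct vertices of non-zero color is positive. $X$ is *$\gamma$-admissible* if every vertex of color $\gamma(0)$ has degree greater than $1$ and $C(\mathrm{rt})\notin\{\gamma(0),\gamma(1)\}$. The pair $(X;\mathbf k)$ is *$\gamma$-harvestable* if $X$ is $\gamma$-admissible, $\deg(\mathrm{rt})=1$, $\deg(v)\le2$ whenever $C(v)\ne0$, $\deg(v)\ne2$ whenever $C(v)=0$, and $\mathbf k_v=0$ implies $C(v)=0$ and $C(p_v)\ne0$. Let $\Delta(X;\mathbf k)$ be the set of $(t_v)_{v\in V}\in[0,1]^V$ such that, for all $v\neq\mathrm{rt}$, $t_v<t_{p_v}$ if $\mathbf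 k_v>0$ and $t_v=t_{p_v}$ if $\mathbf k_v=0$; its independent variables are the $t_v$ with $\mathbf k_v>0$. Put $$I_\gamma(X;\mathbf k)=\int_{\Delta(X;\mathbf k)}\ \prod_{\mathbf k_v>0}\frac{(\log\gamma(t_{p_v})-\log\gamma(t_v))^{\mathbf k_v-1}}{(\mathbf k_v-1)!}\frac{d\gamma(t_v)}{\gamma(t_v)-C(v)}\ \prod_{\mathbf k_v=0}\frac{\gamma(t_v)}{\gamma(t_v)-C(v)},$$ where $\log$ is a continuous branch of the logarithm along $\gamma$, and the factor of $v=\mathrm{rt}$ is $d\gamma(t_{\mathrm{rt}})/(\gamma(t_{\mathrm{rt}})-C(\mathrm{rt}))$. **Proposition.** Let $X=(V,E,\mathrm{rt},C)$ be a $\gamma$-admissible $D$-colored rooted tree and $\mathbf k$ an essentially positive index on $X$. Assume that 1. $C(\mathrm{rt})\neq0$, or $\mathrm{rt}$ has degree $1$ and its edge has positive index; 2. if $\gamma(0)=0$, then $X$ has at least two vertices; 3. if $\gamma(0)\neq0$, then for every vertex $v$ with $C(v)=\gamma(0)$ there is a vertex $w\ne\mathrm{rt}$ with $\mathbf k_w>0$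 such that $p_w$ is joined to $v$ by a (possibly empty) path of edges of index $0$. Then the integral $I_\gamma(X;\mathbf k)$ converges absolutely (coefficientwise), and there is a $\gamma$-harvestable $(D\cup\{0\})$-colored pair $(X_{\mathrm{har}};\mathbf k_{\mathrm{har}})$ whose integral also converges absolutely and satisfies $$I_\gamma(X;\mathbf k)=I_\gamma(X_{\mathrm{har}};\mathbf k_{\mathrm{har}}).$$ -/

import Mathlib

open MeasureTheory Filter Topology
open scoped ContDiff

universe u

noncomputable section

namespace TreeIntegral

/-- Laurent polynomials in the indeterminates `x_1, …, x_r` over `ℂ`. -/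
abbrev LaurentPoly (r : ℕ) : Type := AddMonoidAlgebra ℂ (Fin r → ℤ)

/-- A complex number as a constant Laurent polynomial. -/
abbrev LaurentPoly.const (r : ℕ) (z : ℂ) : LaurentPoly r := algebraMap ℂ (LaurentPoly r) z

section Expansion

variable {r : ℕ} {Γ : Type} [AddCommGroup Γ] [LinearOrder Γ] [IsOrderedAddMonoid Γ]

/-- A Laurent polynomial as a formal series. The isomorphism `mon` of `ℤ^r` with a linearly ordered
group `Γ` is a total order on the monomials `x^m`, compatible with multiplication; it fixes how the
fractions `1 / (z - a)` are expanded into Laurent series, namely in the field of series with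
well-ordered support. -/
def expand (mon : (Fin r → ℤ) ≃+ Γ) (a : LaurentPoly r) : HahnSeries Γ ℂ :=
  a.coeff.sum fun m c => HahnSeries.single (mon m) c

/-- The expansion of `1 / (z - a)` for a complex number `z`. -/
def fraction (mon : (Fin r → ℤ) ≃+ Γ) (z : ℂ) (a : LaurentPoly r) : HahnSeries Γ ℂ :=
  (HahnSeries.C z - expand mon a)⁻¹

/-- For a non-constant `a`, the coefficients of the expansion of `1 / (z - a)` are functions of `z`
whose only possible pole is the constant term of `a`, and this pole occurs exactly when no
monomial of `a` is smaller than `1`. The condition says that there is no such pole on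
`γ([0,1])`. -/
def RegularAlong (mon : (Fin r → ℤ) ≃+ Γ) (γ : ℝ → ℂ) (a : LaurentPoly r) : Prop :=
  (∃ m, mon m < 0 ∧ a.coeff m ≠ 0) ∨ ∀ t ∈ Set.Icc (0 : ℝ) 1, γ t ≠ a.coeff 0

end Expansion

section Paths

/-- A point of `ℂ` with a non-zero tangent vector. -/
structure TangentialBasePoint where
  pt : ℂ
  vec : ℂ
  vec_ne_zero : vec ≠ 0

/-- `γ` is continuous on `[0,1]` and, away from finitely many break points, smooth up to the ends of
each piece. -/
def PiecewiseSmooth (γ : ℝ → ℂ) : Prop :=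
  ContinuousOn γ (Set.Icc 0 1) ∧
    ∃ B : Finset ℝ, ∀ a b : ℝ, 0 ≤ a → a < b → b ≤ 1 → (∀ s ∈ B, s ∉ Set.Ioo a b) →
      ContDiffOn ℝ ∞ γ (Set.Icc a b)

/-- `γ`, restricted to `[0,1]`, is a path from `p` to `q` on `M`. -/
structure IsPathFromTo (γ : ℝ → ℂ) (p q : TangentialBasePoint) (M : Set ℂ) : Prop where
  piecewiseSmooth : PiecewiseSmooth γ
  source : γ 0 = p.pt
  target : γ 1 = q.pt
  tangent_source : Tendsto (fun t : ℝ => (γ t - p.pt) / (t : ℂ)) (𝓝[>] 0) (𝓝 p.vec)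
  tangent_target : Tendsto (fun t : ℝ => (γ t - q.pt) / ((t : ℂ) - 1)) (𝓝[<] 1) (𝓝 (-q.vec))
  mem : ∀ t ∈ Set.Ioo (0 : ℝ) 1, γ t ∈ M

/-- `γ` is a path on `M`, between some tangential base points. -/
def IsPathOn (γ : ℝ → ℂ) (M : Set ℂ) : Prop := ∃ p q, IsPathFromTo γ p q M

/-- `ℂ ∖ D` for a set `D` of Laurent polynomials: the complex numbers that are not in `D`. -/
def complexCompl {r : ℕ} (D : Set (LaurentPoly r)) : Set ℂ := {z | LaurentPoly.const r z ∉ D}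

/-- `log γ(t) - log γ(s)` for a continuous branch of the logarithm along `γ`. -/
def logDiff (γ : ℝ → ℂ) (s t : ℝ) : ℂ := ∫ u in s..t, deriv γ u / γ u

end Paths

/-- A `D`-colored rooted tree. -/
structure ColoredTree {r : ℕ} (D : Set (LaurentPoly r)) where
  V : Type u
  [fintypeV : Fintype V]
  graph : SimpleGraph V
  isTree : graph.IsTree
  root : V
  color : V → LaurentPoly r
  color_mem : ∀ v, color v ∈ D

attribute [instance] ColoredTree.fintypeV

namespace ColoredTree

variable {r : ℕ} {D : Set (LaurentPoly r)} (X : ColoredTree.{u} D)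

/-- The number of edges at `v`. -/
def deg (v : X.V) : ℕ := (X.graph.neighborSet v).ncard

open Classical in
/-- The parent of `v`: the adjacent vertex that is nearer to the root (and `root` for `root`). -/
def parent (v : X.V) : X.V :=
  if h : ∃ w, X.graph.Adj v w ∧ X.graph.dist w X.root < X.graph.dist v X.root then h.choose else v

/-- An index on `X`. -/
abbrev Index : Type u := X.graph.edgeSet → ℕ

variable {X}

open Classical in
/-- `k_v = k({v, p_v})` for `v ≠ root`, and `k_root = 1`. -/
def Index.at (k : X.Index) (v : X.V) : ℕ :=
  if h : X.graph.Adj v (X.parent v) then k ⟨s(v, X.parent v), h⟩ else 1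

open Classical in
/-- The sum of `k(e)` over the edges `e` of a walk. -/
def Index.sumAlong (k : X.Index) {v w : X.V} (p : X.graph.Walk v w) : ℕ :=
  (p.edges.map fun e => if h : e ∈ X.graph.edgeSet then k ⟨e, h⟩ else 0).sum

/-- The sum of `k` over the path between two distinct vertices of non-zero color is positive. -/
def Index.EssentiallyPositive (k : X.Index) : Prop :=
  ∀ v w : X.V, v ≠ w → X.color v ≠ 0 → X.color w ≠ 0 →
    ∀ p : X.graph.Walk v w, p.IsPath → 0 < k.sumAlong p

variable (X) in
/-- `γ`-admissibility. -/
def Admissible (γ : ℝ → ℂ) : Prop :=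
  (∀ v, X.color v = LaurentPoly.const r (γ 0) → 1 < X.deg v) ∧
    X.color X.root ≠ LaurentPoly.const r (γ 0) ∧ X.color X.root ≠ LaurentPoly.const r (γ 1)

/-- `γ`-harvestability of the pair `(X; k)`. -/
structure Harvestable (γ : ℝ → ℂ) (k : X.Index) : Prop where
  admissible : X.Admissible γ
  deg_root : X.deg X.root = 1
  deg_of_ne_zero : ∀ v, X.color v ≠ 0 → X.deg v ≤ 2
  deg_of_eq_zero : ∀ v, X.color v = 0 → X.deg v ≠ 2
  index : ∀ v, k.at v = 0 → X.color v = 0 ∧ X.color (X.parent v) ≠ 0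

/-- The domain `Δ(X; k)`. -/
def domain (k : X.Index) : Set (X.V → ℝ) :=
  {t | (∀ v, t v ∈ Set.Icc (0 : ℝ) 1) ∧
    ∀ v, v ≠ X.root →
      (0 < k.at v → t v < t (X.parent v)) ∧ (k.at v = 0 → t v = t (X.parent v))}

theorem exists_pos_ancestor (k : X.Index) (v : X.V) : ∃ n, 0 < k.at (X.parent^[n] v) := by
  induction hd : X.graph.dist v X.root using Nat.strong_induction_on generalizing v with
  | _ d ih =>
    by_cases hv : 0 < k.at v
    · exact ⟨0, hv⟩
    · have hadj : X.graph.Adj v (X.parent v) := by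
        by_contra hn
        exact hv (by simp [Index.at, hn])
      have hlt : X.graph.dist (X.parent v) X.root < X.graph.dist v X.root := by
        by_cases h : ∃ w, X.graph.Adj v w ∧ X.graph.dist w X.root < X.graph.dist v X.root
        · have : X.parent v = h.choose := dif_pos h
          rw [this]
          exact h.choose_spec.2
        · have : X.parent v = v := dif_neg h
          rw [this] at hadj
          exact absurd hadj (X.graph.irrefl)
      obtain ⟨n, hn⟩ := ih _ (hd ▸ hlt) (X.parent v) rfl
      exact ⟨n + 1, by simpa [Function.iterate_succ_apply] using hn⟩

/-- The vertices `v` with `k_v > 0`; they index the variables of integration. -/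
abbrev FreeVertex (k : X.Index) : Type u := {v : X.V // 0 < k.at v}

/-- The nearest vertex `w` among `v, p_v, p_{p_v}, …` with `k_w > 0`. On `Δ(X; k)` the coordinate
`t_v` equals `t_w`. -/
def carrier (k : X.Index) (v : X.V) : FreeVertex k :=
  ⟨X.parent^[Nat.find (exists_pos_ancestor k v)] v, Nat.find_spec (exists_pos_ancestor k v)⟩

/-- The point of `ℝ^V` with given values of the variables of integration. -/
def point (k : X.Index) (s : FreeVertex k → ℝ) : X.V → ℝ := fun v => s (carrier k v)

section Integral

variable {Γ : Type} [AddCommGroup Γ] [LinearOrder Γ] [IsOrderedAddMonoid Γ]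

/-- The factor `F_{v, k_v}(γ(t))`, without the differential `dt_v`. -/
def factor (mon : (Fin r → ℤ) ≃+ Γ) (γ : ℝ → ℂ) (k : X.Index) (t : X.V → ℝ) (v : X.V) :
    HahnSeries Γ ℂ :=
  if 0 < k.at v then
    (((k.at v - 1).factorial : ℂ)⁻¹ * logDiff γ (t v) (t (X.parent v)) ^ (k.at v - 1)
      * deriv γ (t v)) • fraction mon (γ (t v)) (X.color v)
  else γ (t v) • fraction mon (γ (t v)) (X.color v)

/-- The coefficient at `x^m` of the integrand of `I_γ(X; k)`, in the variables of integration. -/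
def integrand (mon : (Fin r → ℤ) ≃+ Γ) (γ : ℝ → ℂ) (k : X.Index) (m : Fin r → ℤ)
    (s : FreeVertex k → ℝ) : ℂ :=
  (∏ v, factor mon γ k (point k s) v).coeff (mon m)

/-- `Δ(X; k)` in the variables of integration. -/
def freeDomain (k : X.Index) : Set (FreeVertex k → ℝ) := {s | point k s ∈ domain k}

/-- The iterated integral of `(X; k)` converges absolutely, coefficient by coefficient. -/
def Converges (mon : (Fin r → ℤ) ≃+ Γ) (γ : ℝ → ℂ) (k : X.Index) : Prop :=
  ∀ m, IntegrableOn (integrand mon γ k m) (freeDomain k)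

/-- The iterated integral `I_γ(X; k)`, an element of `ℂ⟦x, x⁻¹⟧` given by its coefficients. -/
def iteratedIntegral (mon : (Fin r → ℤ) ≃+ Γ) (γ : ℝ → ℂ) (k : X.Index) :
    (Fin r → ℤ) → ℂ :=
  fun m => ∫ s in freeDomain k, integrand mon γ k m s

end Integral

end ColoredTree

end TreeIntegral

end

/-!
Contracting the edges of index `0` merges vertices on which the domain forces equal times. Essential
positivity leaves at most one non-zero color in each merged class, and a factor `γ / (γ - 0)` is
`1`, so the integral becomes one over a tree all of whose vertices are integration variables.

There, powers of logarithms grow more slowly than any negative power, so up to small exponents the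
factor of a vertex with time `t` is at most `t⁻¹ * (1 - t)⁻¹`. The factor `t⁻¹` is missing at the
leaves, whose color is not `γ 0`, and `(1 - t)⁻¹` is missing at the root, whose color is not `γ 1`.
The product of the times of the leaves is at most every time, and the root has the largest time, so
the missing factors can be spread over all vertices, which leaves a convergent beta integral at
each of them.

A non-root vertex of color `0` with exactly one child is removed by
`∫ (log γ(y) - log γ(u))^a / a! * (log γ(u) - log γ(x))^b / b! dγ(u) / γ(u)
= (log γ(y) - log γ(x))^(a+b+1) / (a+b+1)!`, the integral being over `x < u < y`. Finally a
branching vertex of non-zero color, or a root without children, gets a new child of color `0`,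
joined to it by an edge of index `0` and adopting all its former children. This multiplies the
integrand by `γ / (γ - 0) = 1`.
-/

noncomputable section

namespace TreeIntegral

/-- A rooted tree on the vertex set `V`, encoded by the map sending a vertex to its parent; the root
is its own parent. A height function that decreases towards the root rules out cycles. -/
@[ext]
structure ParentMap (V : Type*) where
  root : V
  parent : V → V
  parent_root : parent root = root
  exists_height : ∃ h : V → ℕ, ∀ v, v ≠ root → h (parent v) < h v

namespace ParentMap

variable {V : Type*} (T : ParentMap V)

theorem induction {P : V → Prop} (root : P T.root)
    (step : ∀ v, v ≠ T.root → P (T.parent v) → P v) (v : V) : P v := by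
  obtain ⟨h, hh⟩ := T.exists_height
  induction hd : h v using Nat.strong_induction_on generalizing v with
  | _ d ih =>
    by_cases hv : v = T.root
    · exact hv ▸ root
    · exact step v hv (ih _ (hd ▸ hh v hv) _ rfl)

variable {T}

theorem parent_ne {v : V} (hv : v ≠ T.root) : T.parent v ≠ v := by
  obtain ⟨h, hh⟩ := T.exists_height
  intro e
  exact (hh v hv).ne (by rw [e])

theorem parent_parent_ne {v : V} (hv : v ≠ T.root) : T.parent (T.parent v) ≠ v := by
  obtain ⟨h, hh⟩ := T.exists_height
  by_cases hp : T.parent v = T.root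
  · rw [hp, T.parent_root]
    exact hv.symm
  · intro e
    exact ((hh _ hp).trans (hh v hv)).ne (by rw [e])

variable (T)

/-- The vertices whose parent is `v`; the root does not count as a child of itself. -/
def children (v : V) : Set V := {w | w ≠ T.root ∧ T.parent w = v}

/-- The graph in which every vertex is joined to its parent. -/
def graph : SimpleGraph V := SimpleGraph.fromRel fun v w => w = T.parent v

variable {T}

theorem graph_adj_parent {v : V} (hv : v ≠ T.root) : T.graph.Adj v (T.parent v) :=
  (SimpleGraph.fromRel_adj _ _ _).2 ⟨(parent_ne hv).symm, Or.inl rfl⟩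

variable (T)

theorem graph_connected : T.graph.Connected := by
  have reachable_root (v : V) : T.graph.Reachable v T.root :=
    T.induction (.refl _) (fun _ hv ih => (graph_adj_parent hv).reachable.trans ih) v
  exact { preconnected := fun v w => (reachable_root v).trans (reachable_root w).symm
          nonempty := ⟨T.root⟩ }

theorem graph_isTree [Finite V] : T.graph.IsTree := by
  rw [SimpleGraph.isTree_iff_connected_and_card]
  refine ⟨T.graph_connected,
    le_antisymm ?_ T.graph_connected.card_vert_le_card_edgeSet_add_one⟩
  let parentEdge : {v : V // v ≠ T.root} → T.graph.edgeSet := fun v =>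
    ⟨s(v.1, T.parent v.1), graph_adj_parent v.2⟩
  have parentEdge_surjective : Function.Surjective parentEdge := by
    rintro ⟨e, he⟩
    induction e using Sym2.ind with
    | _ a b =>
      rw [SimpleGraph.mem_edgeSet, graph, SimpleGraph.fromRel_adj] at he
      obtain ⟨hne, rfl | rfl⟩ := he
      · exact ⟨⟨a, fun ha => hne (by rw [ha, T.parent_root])⟩, rfl⟩
      · exact ⟨⟨b, fun hb => hne (by rw [hb, T.parent_root])⟩, Subtype.ext Sym2.eq_swap⟩
  have hcard := Nat.card_le_card_of_surjective _ parentEdge_surjective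
  have := Set.ncard_add_ncard_compl {T.root}
  rw [Set.ncard_singleton] at this
  have hcompl : ({T.root}ᶜ : Set V).ncard = Nat.card {v : V // v ≠ T.root} := rfl
  omega

end ParentMap

namespace ColoredTree

variable {r : ℕ} {D : Set (LaurentPoly r)} (X : ColoredTree.{u} D)

section Parent

variable {X}

theorem exists_adj_dist_lt {v : X.V} (hv : v ≠ X.root) :
    ∃ w, X.graph.Adj v w ∧ X.graph.dist w X.root < X.graph.dist v X.root := by
  obtain ⟨p, hp⟩ := X.isTree.connected.exists_walk_length_eq_dist v X.root
  cases p with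
  | nil => exact absurd rfl hv
  | cons hadj q =>
    refine ⟨_, hadj, ?_⟩
    have := X.graph.dist_le q
    rw [SimpleGraph.Walk.length_cons] at hp
    omega

theorem parent_eq_choose {v : X.V} (hv : v ≠ X.root) :
    X.parent v = (exists_adj_dist_lt hv).choose := dif_pos _

theorem adj_parent {v : X.V} (hv : v ≠ X.root) : X.graph.Adj v (X.parent v) :=
  parent_eq_choose hv ▸ (exists_adj_dist_lt hv).choose_spec.1

theorem dist_parent_lt {v : X.V} (hv : v ≠ X.root) :
    X.graph.dist (X.parent v) X.root < X.graph.dist v X.root :=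
  parent_eq_choose hv ▸ (exists_adj_dist_lt hv).choose_spec.2

end Parent

theorem parent_root : X.parent X.root = X.root := dif_neg (by simp)

/-- The parent map underlying a colored tree. -/
@[simps]
def parentMap : ParentMap X.V where
  root := X.root
  parent := X.parent
  parent_root := X.parent_root
  exists_height := ⟨fun v => X.graph.dist v X.root, fun _ => dist_parent_lt⟩

/-- The edge joining a vertex other than the root to its parent. -/
def parentEdge (v : {v : X.V // v ≠ X.root}) : X.graph.edgeSet :=
  ⟨s(v.1, X.parent v.1), adj_parent v.2⟩

theorem parentEdge_injective : Function.Injective X.parentEdge := by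
  rintro ⟨v, hv⟩ ⟨w, hw⟩ h
  rcases Sym2.eq_iff.1 (congrArg Subtype.val h) with ⟨hvw, -⟩ | ⟨hvw, hwv⟩
  · exact Subtype.ext hvw
  · dsimp only at hvw hwv
    rw [hvw] at hwv
    exact absurd hwv (X.parentMap.parent_parent_ne hw)

theorem parentEdge_bijective : Function.Bijective X.parentEdge := by
  classical
  refine (Fintype.bijective_iff_injective_and_card _).2 ⟨X.parentEdge_injective, ?_⟩
  have hedges := X.isTree.card_edgeFinset
  have hvertices : Fintype.card {v : X.V // v ≠ X.root} = Fintype.card X.V - 1 := by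
    rw [Fintype.card_subtype_compl, Fintype.card_subtype_eq]
  rw [SimpleGraph.edgeFinset_card] at hedges
  omega

variable {X}

theorem eq_parent_or_eq_parent {v w : X.V} (h : X.graph.Adj v w) :
    v ≠ X.root ∧ w = X.parent v ∨ w ≠ X.root ∧ v = X.parent w := by
  obtain ⟨⟨a, ha⟩, hedge⟩ := X.parentEdge_bijective.2 ⟨s(v, w), h⟩
  rcases Sym2.eq_iff.1 (congrArg Subtype.val hedge) with ⟨rfl, rfl⟩ | ⟨rfl, rfl⟩
  · exact Or.inl ⟨ha, rfl⟩
  · exact Or.inr ⟨ha, rfl⟩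

theorem adj_iff {v w : X.V} :
    X.graph.Adj v w ↔ w ∈ X.parentMap.children v ∨ v ∈ X.parentMap.children w := by
  constructor
  · intro h
    rcases eq_parent_or_eq_parent h with ⟨hv, rfl⟩ | ⟨hw, rfl⟩
    · exact Or.inr ⟨hv, rfl⟩
    · exact Or.inl ⟨hw, rfl⟩
  · rintro (⟨hw, rfl⟩ | ⟨hv, rfl⟩)
    · exact (adj_parent hw).symm
    · exact adj_parent hv

variable (X) in
theorem deg_root : X.deg X.root = (X.parentMap.children X.root).ncard := by
  rw [deg]
  congr 1
  ext w
  rw [SimpleGraph.mem_neighborSet, adj_iff]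
  exact or_iff_left fun h => h.1 rfl

theorem deg_of_ne_root {v : X.V} (hv : v ≠ X.root) :
    X.deg v = (X.parentMap.children v).ncard + 1 := by
  have hparent : X.parent v ∉ X.parentMap.children v := fun h =>
    X.parentMap.parent_parent_ne hv h.2
  rw [← Set.ncard_insert_of_notMem hparent (Set.toFinite _), deg]
  congr 1
  ext w
  rw [SimpleGraph.mem_neighborSet, adj_iff, Set.mem_insert_iff, or_comm]
  exact or_congr_left ⟨fun h => h.2.symm, fun h => ⟨hv, h.symm⟩⟩

section OfParentMap

variable {V : Type u} [Fintype V] (T : ParentMap V) {color : V → LaurentPoly r}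
  (hcolor : ∀ v, color v ∈ D)

/-- The colored tree given by a parent map and a coloring. -/
abbrev ofParentMap : ColoredTree.{u} D where
  V := V
  graph := T.graph
  isTree := T.graph_isTree
  root := T.root
  color := color
  color_mem := hcolor

theorem parentMap_ofParentMap : (ofParentMap T hcolor).parentMap = T := by
  refine ParentMap.ext rfl (funext fun v => ?_)
  change (ofParentMap T hcolor).parent v = T.parent v
  induction v using T.induction with
  | root => exact (ofParentMap T hcolor).parent_root.trans T.parent_root.symm
  | step v hv ih =>
    rcases eq_parent_or_eq_parent (X := ofParentMap T hcolor) (ParentMap.graph_adj_parent hv) with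
      ⟨-, hp⟩ | ⟨-, hp⟩
    · exact hp.symm
    · exact absurd (hp.trans ih).symm (ParentMap.parent_parent_ne hv)

end OfParentMap

theorem Index.at_root (k : X.Index) : k.at X.root = 1 :=
  dif_neg (by rw [parent_root]; exact X.graph.irrefl)

theorem Index.at_of_ne_root (k : X.Index) {v : X.V} (hv : v ≠ X.root) :
    k.at v = k (X.parentEdge ⟨v, hv⟩) := dif_pos _

theorem exists_index_at_eq {f : X.V → ℕ} (hf : f X.root = 1) : ∃ k : X.Index, k.at = f := by
  refine ⟨Function.extend X.parentEdge (fun v => f v) 0, funext fun v => ?_⟩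
  by_cases hv : v = X.root
  · rw [hv, Index.at_root, hf]
  · rw [Index.at_of_ne_root _ hv, X.parentEdge_injective.extend_apply]

theorem Index.ne_root_of_at_eq_zero {k : X.Index} {v : X.V} (hv : k.at v = 0) : v ≠ X.root := by
  rintro rfl
  rw [k.at_root] at hv
  exact one_ne_zero hv

section Carrier

variable (k : X.Index)

theorem carrier_induction {P : X.V → Prop} (free : ∀ v, 0 < k.at v → P v)
    (step : ∀ v, k.at v = 0 → P (X.parent v) → P v) (v : X.V) : P v := by
  refine X.parentMap.induction (free _ (k.at_root ▸ one_pos)) (fun v _ ih => ?_) v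
  rcases Nat.eq_zero_or_pos (k.at v) with hv | hv
  · exact step v hv ih
  · exact free v hv

theorem carrier_of_pos {v : X.V} (hv : 0 < k.at v) : carrier k v = ⟨v, hv⟩ := by
  have hfind : Nat.find (exists_pos_ancestor k v) = 0 := (Nat.find_eq_zero _).2 hv
  refine Subtype.ext ?_
  simp only [carrier, hfind, Function.iterate_zero_apply]

theorem carrier_parent {v : X.V} (hv : k.at v = 0) : carrier k (X.parent v) = carrier k v := by
  have hfind : Nat.find (exists_pos_ancestor k v) =
      Nat.find (exists_pos_ancestor k (X.parent v)) + 1 := by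
    rw [Nat.find_comp_succ (exists_pos_ancestor k v)
      (by simpa only [Function.iterate_succ_apply] using exists_pos_ancestor k (X.parent v))
      (by simp only [Function.iterate_zero_apply, hv, lt_irrefl, not_false_iff])]
    congr 1
  refine Subtype.ext ?_
  simp only [carrier, hfind, Function.iterate_succ_apply]

theorem carrier_root : (carrier k X.root).1 = X.root := by
  rw [carrier_of_pos k (k.at_root ▸ one_pos)]

theorem exists_walk_carrier (v : X.V) :
    ∃ p : X.graph.Walk v (carrier k v).1,
      ∀ e ∈ p.edges, ∀ h : e ∈ X.graph.edgeSet, k ⟨e, h⟩ = 0 := by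
  induction v using carrier_induction k with
  | free v hv =>
    rw [carrier_of_pos k hv]
    exact ⟨.nil, by simp⟩
  | step v hv ih =>
    rw [carrier_parent k hv] at ih
    obtain ⟨p, hp⟩ := ih
    have hroot := Index.ne_root_of_at_eq_zero hv
    refine ⟨.cons (adj_parent hroot) p, fun e he h => ?_⟩
    rw [SimpleGraph.Walk.edges_cons, List.mem_cons] at he
    rcases he with rfl | he
    · exact (k.at_of_ne_root hroot).symm.trans hv
    · exact hp e he h

variable {k}

theorem Index.EssentiallyPositive.eq_of_carrier_eq (hk : k.EssentiallyPositive)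
    {v w : X.V} (hv : X.color v ≠ 0) (hw : X.color w ≠ 0) (h : carrier k v = carrier k w) :
    v = w := by
  classical
  by_contra hne
  obtain ⟨p, hp⟩ := exists_walk_carrier k v
  obtain ⟨q, hq⟩ : ∃ q : X.graph.Walk w (carrier k v).1,
      ∀ e ∈ q.edges, ∀ h : e ∈ X.graph.edgeSet, k ⟨e, h⟩ = 0 := h ▸ exists_walk_carrier k w
  refine (hk v w hne hv hw _ (p.append q.reverse).bypass_isPath).ne'
    (List.sum_eq_zero fun n hn => ?_)
  obtain ⟨e, he, rfl⟩ := List.mem_map.1 hn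
  have hmem := SimpleGraph.Walk.edges_bypass_subset_edges _ he
  rw [SimpleGraph.Walk.edges_append, List.mem_append, SimpleGraph.Walk.edges_reverse,
    List.mem_reverse] at hmem
  split_ifs with hedge
  · exact hmem.elim (hp e · hedge) (hq e · hedge)
  · rfl

end Carrier

end ColoredTree

theorem prod_smul_hahnSeries {ι Γ R : Type*} [AddCommMonoid Γ] [PartialOrder Γ]
    [IsOrderedCancelAddMonoid Γ] [CommSemiring R] (t : Finset ι) (a : ι → R)
    (f : ι → HahnSeries Γ R) : ∏ i ∈ t, a i • f i = (∏ i ∈ t, a i) • ∏ i ∈ t, f i :=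
  Finset.prod_smul ..

theorem LaurentPoly.const_eq_zero {r : ℕ} {c : ℂ} : LaurentPoly.const r c = 0 ↔ c = 0 :=
  map_eq_zero _

section Fraction

variable {r : ℕ} {Γ : Type} [AddCommGroup Γ] [LinearOrder Γ] [IsOrderedAddMonoid Γ]
  (mon : (Fin r → ℤ) ≃+ Γ)

theorem expand_const (c : ℂ) : expand mon (LaurentPoly.const r c) = HahnSeries.C c := by
  rw [expand, LaurentPoly.const, AddMonoidAlgebra.coe_algebraMap]
  simp

theorem fraction_const (z c : ℂ) :
    fraction mon z (LaurentPoly.const r c) = HahnSeries.C (z - c)⁻¹ := by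
  rw [fraction, expand_const, ← map_sub, map_inv₀]

theorem fraction_zero (z : ℂ) : fraction mon z 0 = HahnSeries.C z⁻¹ := by
  simpa only [LaurentPoly.const, map_zero, sub_zero] using fraction_const mon z 0

theorem smul_fraction_zero {z : ℂ} (hz : z ≠ 0) : z • fraction mon z 0 = 1 := by
  rw [fraction_zero, ← HahnSeries.C_mul_eq_smul, ← map_mul, mul_inv_cancel₀ hz, map_one]

end Fraction

/-- A rooted tree on `V` with colored vertices and positive indices, where `idx v` is the index of
the edge joining `v` to its parent. All vertices are variables of integration. -/
structure PosTree (r : ℕ) (V : Type*) extends ParentMap V where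
  color : V → LaurentPoly r
  idx : V → ℕ
  idx_root : idx root = 1
  idx_pos : ∀ v, 0 < idx v

namespace PosTree

variable {r : ℕ} {V : Type*} (N : PosTree r V)

/-- The domain of integration without its faces on the boundary of the cube, where `γ` may meet
the colors. -/
def domain : Set (V → ℝ) :=
  {s | (∀ v, s v ∈ Set.Ioo (0 : ℝ) 1) ∧ ∀ v, v ≠ N.root → s v < s (N.parent v)}

theorem measurableSet_domain [Countable V] : MeasurableSet N.domain := by
  simp only [domain, Set.ofPred_and, Set.ofPred_forall]
  exact (MeasurableSet.iInter fun v => measurable_pi_apply v measurableSet_Ioo).inter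
    (MeasurableSet.iInter fun v => MeasurableSet.iInter fun _ =>
      measurableSet_lt (measurable_pi_apply v) (measurable_pi_apply (N.parent v)))

/-- The power of `log γ(s_{p_v}) - log γ(s_v)` in the factor of the vertex `v`. -/
def logPower (γ : ℝ → ℂ) (s : V → ℝ) (v : V) : ℂ :=
  ((N.idx v - 1).factorial : ℂ)⁻¹ * logDiff γ (s v) (s (N.parent v)) ^ (N.idx v - 1)

variable {Γ : Type} [AddCommGroup Γ] [LinearOrder Γ] [IsOrderedAddMonoid Γ] [Fintype V]

/-- The coefficient at `x^m` of the integrand. -/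
def integrand (mon : (Fin r → ℤ) ≃+ Γ) (γ : ℝ → ℂ) (m : Fin r → ℤ) (s : V → ℝ) : ℂ :=
  (∏ v, N.logPower γ s v * deriv γ (s v)) *
    (∏ v, fraction mon (γ (s v)) (N.color v)).coeff (mon m)

/-- Absolute convergence of the integral, coefficient by coefficient. -/
def Converges (mon : (Fin r → ℤ) ≃+ Γ) (γ : ℝ → ℂ) : Prop :=
  ∀ m, IntegrableOn (N.integrand mon γ m) N.domain

/-- The integral of the tree, given by its coefficients. -/
def integral (mon : (Fin r → ℤ) ≃+ Γ) (γ : ℝ → ℂ) : (Fin r → ℤ) → ℂ :=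
  fun m => ∫ s in N.domain, N.integrand mon γ m s

end PosTree

namespace ColoredTree

variable {r : ℕ} {D : Set (LaurentPoly r)} {X : ColoredTree.{u} D} {V : Type*}

/-- The map `c` exhibits `N` as the tree obtained from `(X; k)` by contracting the edges of index
zero, where at most one of the vertices merged into `v` has a non-zero color, and `v` inherits
it. -/
structure IsContraction (k : X.Index) (N : PosTree r V) (c : X.V → V) : Prop where
  bijective : Function.Bijective fun x : FreeVertex k => c x
  map_root : c X.root = N.root
  map_parent : ∀ x, 0 < k.at x → c (X.parent x) = N.parent (c x)
  map_parent_of_eq_zero : ∀ x, k.at x = 0 → c (X.parent x) = c x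
  idx : ∀ x, 0 < k.at x → N.idx (c x) = k.at x
  color : ∀ v, ∃ x, c x = v ∧ X.color x = N.color v ∧ ∀ y, y ≠ x → c y = v → X.color y = 0

namespace IsContraction

variable {k : X.Index} {N : PosTree r V} {c : X.V → V} (hN : IsContraction k N c)
include hN

theorem map_carrier (x : X.V) : c (carrier k x) = c x := by
  induction x using carrier_induction k with
  | free x hx => rw [carrier_of_pos k hx]
  | step x hx ih => rwa [carrier_parent k hx, hN.map_parent_of_eq_zero x hx] at ih

theorem point_comp (s : V → ℝ) : point k (fun x => s (c x)) = s ∘ c :=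
  funext fun x => congrArg s (hN.map_carrier x)

theorem surjective : Function.Surjective c := fun v =>
  let ⟨x, hx⟩ := hN.bijective.2 v
  ⟨x, hx⟩

theorem map_eq_root_iff {x : X.V} (hx : 0 < k.at x) : c x = N.root ↔ x = X.root := by
  refine ⟨fun h => ?_, fun h => h ▸ hN.map_root⟩
  have hfree : (⟨x, hx⟩ : FreeVertex k) = ⟨X.root, k.at_root ▸ one_pos⟩ :=
    hN.bijective.1 (h.trans hN.map_root.symm)
  exact congrArg Subtype.val hfree

theorem comp_mem_domain_iff (s : V → ℝ) :
    s ∘ c ∈ X.domain k ↔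
      (∀ v, s v ∈ Set.Icc (0 : ℝ) 1) ∧ ∀ v, v ≠ N.root → s v < s (N.parent v) := by
  refine and_congr (hN.surjective.forall (p := fun v => s v ∈ Set.Icc (0 : ℝ) 1)).symm
    ⟨fun h v hv => ?_, fun h x hx =>
      ⟨fun hpos => ?_, fun hzero => congrArg s (hN.map_parent_of_eq_zero x hzero).symm⟩⟩
  · obtain ⟨⟨x, hx⟩, rfl⟩ := hN.bijective.2 v
    rw [← hN.map_parent x hx]
    exact (h x (mt (hN.map_eq_root_iff hx).2 hv)).1 hx
  · rw [Function.comp_apply, Function.comp_apply, hN.map_parent x hpos]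
    exact h _ (mt (hN.map_eq_root_iff hpos).1 hx)

/-- The vertices of `N` as the variables of integration of `(X; k)`. -/
def freeEquiv : FreeVertex k ≃ V := Equiv.ofBijective _ hN.bijective

theorem mem_freeDomain_iff (s : FreeVertex k → ℝ) :
    s ∈ freeDomain k ↔ (∀ x, s x ∈ Set.Icc (0 : ℝ) 1) ∧
      ∀ v, v ≠ N.root → s (hN.freeEquiv.symm v) < s (hN.freeEquiv.symm (N.parent v)) := by
  have hpoint : point k s = (fun v => s (hN.freeEquiv.symm v)) ∘ c := by
    rw [← hN.point_comp]
    exact congrArg (point k) (funext fun x => congrArg s (hN.freeEquiv.symm_apply_apply x).symm)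
  rw [freeDomain, Set.mem_ofPred_eq, hpoint, hN.comp_mem_domain_iff]
  exact and_congr_left' (hN.freeEquiv.symm.forall_congr_right
    (q := fun x => s x ∈ Set.Icc (0 : ℝ) 1))

theorem freeDomain_ae_eq :
    freeDomain k =ᵐ[volume] {s | (fun v => s (hN.freeEquiv.symm v)) ∈ N.domain} := by
  have hIcc : freeDomain k = freeDomain k ∩ Set.Icc 0 1 := by
    refine (Set.inter_eq_left.2 fun s hs => ?_).symm
    have h := ((hN.mem_freeDomain_iff s).1 hs).1
    exact ⟨fun x => (h x).1, fun x => (h x).2⟩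
  have hIoo : {s | (fun v => s (hN.freeEquiv.symm v)) ∈ N.domain} =
      freeDomain k ∩ Set.univ.pi fun _ => Set.Ioo (0 : ℝ) 1 := by
    ext s
    rw [Set.mem_inter_iff, hN.mem_freeDomain_iff, Set.mem_univ_pi, ←
      hN.freeEquiv.symm.forall_congr_right (q := fun x => s x ∈ Set.Ioo (0 : ℝ) 1)]
    exact ⟨fun h => ⟨⟨fun x => by
      simpa using Set.Ioo_subset_Icc_self (h.1 (hN.freeEquiv x)), h.2⟩, h.1⟩,
      fun h => ⟨h.2, h.1.2⟩⟩
  rw [hIoo]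
  conv_lhs => rw [hIcc]
  exact (ae_eq_refl _).inter (Measure.univ_pi_Ioo_ae_eq_Icc
    (μ := fun _ : FreeVertex k => (volume : Measure ℝ)) (f := 0) (g := 1)).symm

section Integral

variable {Γ : Type} [AddCommGroup Γ] [LinearOrder Γ] [IsOrderedAddMonoid Γ]
  (mon : (Fin r → ℤ) ≃+ Γ) {γ : ℝ → ℂ} {s : V → ℝ}

theorem factor_comp (x : X.V) (hx : γ (s (c x)) ≠ 0) :
    factor mon γ k (s ∘ c) x =
      (if 0 < k.at x then N.logPower γ s (c x) * deriv γ (s (c x)) * (γ (s (c x)))⁻¹ else 1) •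
        γ (s (c x)) • fraction mon (γ (s (c x))) (X.color x) := by
  unfold factor
  split_ifs with hpos
  · rw [smul_smul, inv_mul_cancel_right₀ hx, PosTree.logPower, hN.idx x hpos,
      ← hN.map_parent x hpos]
    rfl
  · rw [one_smul]
    rfl

open Classical in
theorem prod_fiber_fraction (v : V) {z : ℂ} (hz : z ≠ 0) :
    ∏ x with c x = v, z • fraction mon z (X.color x) = z • fraction mon z (N.color v) := by
  obtain ⟨x, rfl, hx, hother⟩ := hN.color v
  rw [← hx]
  refine Finset.prod_eq_single_of_mem x (by simp) fun y hy hne => ?_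
  rw [hother y hne (Finset.mem_filter.1 hy).2, smul_fraction_zero mon hz]

variable [Fintype V]

omit [AddCommGroup Γ] [LinearOrder Γ] [IsOrderedAddMonoid Γ] in
theorem prod_free (f : V → ℂ) : ∏ x, (if 0 < k.at x then f (c x) else 1) = ∏ v, f v := by
  rw [← Finset.prod_filter, ← hN.freeEquiv.prod_comp]
  exact Finset.prod_subtype _ (by simp) fun x => f (c x)

theorem prod_factor_comp (hs : ∀ v, γ (s v) ≠ 0) :
    ∏ x, factor mon γ k (s ∘ c) x =
      (∏ v, N.logPower γ s v * deriv γ (s v)) • ∏ v, fraction mon (γ (s v)) (N.color v) := by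
  classical
  have prod_fraction : ∏ x, γ (s (c x)) • fraction mon (γ (s (c x))) (X.color x) =
      ∏ v, γ (s v) • fraction mon (γ (s v)) (N.color v) := by
    rw [← Finset.prod_fiberwise (s := Finset.univ) (g := c)]
    refine Finset.prod_congr rfl fun v _ => ?_
    rw [← hN.prod_fiber_fraction mon v (hs v)]
    exact Finset.prod_congr rfl fun x hx => by rw [(Finset.mem_filter.1 hx).2]
  rw [Finset.prod_congr rfl fun x _ => hN.factor_comp mon x (hs (c x)), prod_smul_hahnSeries,
    prod_fraction, hN.prod_free fun v => N.logPower γ s v * deriv γ (s v) * (γ (s v))⁻¹,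
    prod_smul_hahnSeries, smul_smul, ← Finset.prod_mul_distrib]
  simp only [inv_mul_cancel_right₀ (hs _)]

theorem integrand_comp (hs : ∀ v, γ (s v) ≠ 0) (m : Fin r → ℤ) :
    integrand mon γ k m (fun x => s (c x)) = N.integrand mon γ m s := by
  rw [integrand, hN.point_comp, hN.prod_factor_comp mon hs, HahnSeries.coeff_smul, smul_eq_mul,
    PosTree.integrand]

theorem converges_iff_and_iteratedIntegral_eq (hγ : ∀ t ∈ Set.Ioo (0 : ℝ) 1, γ t ≠ 0) :
    (Converges mon γ k ↔ N.Converges mon γ) ∧ iteratedIntegral mon γ k = N.integral mon γ := by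
  let Φ := MeasurableEquiv.arrowCongr' hN.freeEquiv (.refl ℝ)
  have hΦ : MeasurePreserving Φ := volume_preserving_arrowCongr' _ _ (.id _)
  have hmeas : MeasurableSet (Φ ⁻¹' N.domain) := Φ.measurable N.measurableSet_domain
  have hdomain : freeDomain k =ᵐ[volume] Φ ⁻¹' N.domain := hN.freeDomain_ae_eq
  have hintegrand (m : Fin r → ℤ) :
      Set.EqOn (integrand mon γ k m) (N.integrand mon γ m ∘ Φ) (Φ ⁻¹' N.domain) := fun s hs => by
    rw [Function.comp_apply, ← hN.integrand_comp mon fun v => hγ _ (hs.1 v)]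
    exact congrArg _ (funext fun x => congrArg s (hN.freeEquiv.symm_apply_apply x).symm)
  refine ⟨forall_congr' fun m => ?_, funext fun m => ?_⟩
  · rw [integrableOn_congr_set_ae hdomain, integrableOn_congr_fun (hintegrand m) hmeas]
    exact hΦ.integrableOn_comp_preimage Φ.measurableEmbedding
  · rw [iteratedIntegral, setIntegral_congr_set hdomain,
      setIntegral_congr_fun hmeas (hintegrand m)]
    exact hΦ.setIntegral_preimage_emb Φ.measurableEmbedding _ _

end Integral

end IsContraction

end ColoredTree

namespace PosTree

/-- The conditions on a tree with positive indices which make its integral converge and which are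
preserved when vertices of color zero with a single child are removed. -/
structure Admissible {r : ℕ} {V : Type*} (N : PosTree r V) (D : Set (LaurentPoly r))
    (γ : ℝ → ℂ) : Prop where
  color_mem : ∀ v, N.color v ∈ insert 0 D
  leaf : ∀ v, N.children v = ∅ → N.color v ≠ LaurentPoly.const r (γ 0)
  root_ne_source : N.color N.root ≠ LaurentPoly.const r (γ 0)
  root_ne_target : N.color N.root ≠ LaurentPoly.const r (γ 1)
  root_zero : N.color N.root = 0 → (N.children N.root).ncard = 1
  root_child : γ 0 = 0 → (N.children N.root).Nonempty

end PosTree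

namespace ColoredTree

variable {r : ℕ} {D : Set (LaurentPoly r)} {X : ColoredTree.{u} D} {k : X.Index} {γ : ℝ → ℂ}

theorem IsContraction.color_eq_zero_or_eq {V : Type*} {N : PosTree r V} {c : X.V → V}
    (hN : IsContraction k N c) (x : X.V) : X.color x = 0 ∨ X.color x = N.color (c x) := by
  obtain ⟨y, hy, hcolor, hzero⟩ := hN.color (c x)
  rcases eq_or_ne x y with rfl | hne
  · exact Or.inr hcolor
  · exact Or.inl (hzero x hne rfl)

variable (k) in
theorem dist_carrier_le (v : X.V) :
    X.graph.dist (carrier k v).1 X.root ≤ X.graph.dist v X.root := by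
  induction v using carrier_induction k with
  | free v hv => rw [carrier_of_pos k hv]
  | step v hv ih =>
    rw [← carrier_parent k hv]
    exact ih.trans (dist_parent_lt (Index.ne_root_of_at_eq_zero hv)).le

open Classical in
/-- The vertex whose color survives when all vertices with carrier `v` are merged. -/
def representative (v : FreeVertex k) : X.V :=
  if h : ∃ x, carrier k x = v ∧ X.color x ≠ 0 then h.choose else v.1

theorem carrier_representative (v : FreeVertex k) : carrier k (representative v) = v := by
  rw [representative]
  split_ifs with h
  · exact h.choose_spec.1
  · exact carrier_of_pos k v.2

theorem color_eq_zero_of_ne_representative (hk : k.EssentiallyPositive) {v : FreeVertex k}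
    {x : X.V} (hne : x ≠ representative v) (hx : carrier k x = v) : X.color x = 0 := by
  by_contra hcolor
  have hex : ∃ x, carrier k x = v ∧ X.color x ≠ 0 := ⟨x, hx, hcolor⟩
  rw [representative, dif_pos hex] at hne
  exact hne (hk.eq_of_carrier_eq hcolor hex.choose_spec.2 (hx.trans hex.choose_spec.1.symm))

variable (k) in
/-- The tree with positive indices that arises by contracting the edges of index zero. -/
def contractZero : PosTree r (FreeVertex k) where
  root := carrier k X.root
  parent v := carrier k (X.parent v)
  parent_root := by rw [carrier_root, parent_root]
  exists_height := by
    refine ⟨fun v => X.graph.dist v.1 X.root, fun v hv => ?_⟩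
    refine (dist_carrier_le k _).trans_lt (dist_parent_lt fun h => hv ?_)
    exact Subtype.ext (h.trans (carrier_root k).symm)
  color v := X.color (representative v)
  idx v := k.at v
  idx_root := by rw [carrier_root, Index.at_root]
  idx_pos v := v.2

theorem isContraction_contractZero (hk : k.EssentiallyPositive) :
    IsContraction k (contractZero k) (carrier k) where
  bijective := by
    have hid : (fun x : FreeVertex k => carrier k x) = id := funext fun x => carrier_of_pos k x.2
    exact hid ▸ Function.bijective_id
  map_root := rfl
  map_parent x hx := by rw [carrier_of_pos k hx]; rfl
  map_parent_of_eq_zero _ := carrier_parent k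
  idx x hx := by rw [carrier_of_pos k hx]; rfl
  color v := ⟨representative v, carrier_representative v, rfl,
    fun _ => color_eq_zero_of_ne_representative hk⟩

theorem mem_children_contractZero {v w : FreeVertex k} :
    w ∈ (contractZero k).children v ↔ w.1 ≠ X.root ∧ carrier k (X.parent w) = v := by
  refine and_congr_left' (not_congr ?_)
  rw [Subtype.ext_iff]
  exact Iff.of_eq (congrArg _ (carrier_root k))

theorem exists_leaf_of_contractZero_leaf {v : FreeVertex k}
    (hv : (contractZero k).children v = ∅) :
    ∃ x, carrier k x = v ∧ X.parentMap.children x = ∅ := by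
  have hfinite : {x | carrier k x = v}.Finite := Set.toFinite _
  obtain ⟨x, hx, hmax⟩ := hfinite.exists_maximalFor (fun x => X.graph.dist x X.root) _
    ⟨v.1, carrier_of_pos k v.2⟩
  refine ⟨x, hx, Set.eq_empty_of_forall_notMem fun y ⟨hy, hparent⟩ => ?_⟩
  rw [parentMap_parent] at hparent
  rcases Nat.eq_zero_or_pos (k.at y) with hzero | hpos
  · have hlt := dist_parent_lt hy
    have hcarrier : carrier k y = v := by
      rw [← carrier_parent k hzero, hparent, hx]
    rw [hparent] at hlt
    exact hlt.not_ge (hmax hcarrier hlt.le)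
  · have hchild : ⟨y, hpos⟩ ∈ (contractZero k).children v :=
      mem_children_contractZero.2 ⟨hy, hparent ▸ hx⟩
    exact hv.le hchild

theorem children_nonempty_of_one_lt_deg {v : X.V} (h : 1 < X.deg v) :
    (X.parentMap.children v).Nonempty := by
  apply Set.nonempty_of_ncard_ne_zero
  rcases eq_or_ne v X.root with rfl | hv
  · rw [deg_root] at h
    omega
  · rw [deg_of_ne_root hv] at h
    omega

theorem children_root_nonempty [Nontrivial X.V] : (X.parentMap.children X.root).Nonempty := by
  obtain ⟨w, hw⟩ := X.isTree.connected.preconnected.exists_adj_of_nontrivial X.root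
  exact ⟨w, (adj_iff.1 hw).resolve_right fun h => h.1 rfl⟩

theorem eq_root_of_carrier_eq (hpos : ∀ w, X.graph.Adj w X.root → 0 < k.at w) {x : X.V}
    (hx : carrier k x = carrier k X.root) : x = X.root := by
  induction x using carrier_induction k with
  | free x hfree =>
    rw [← carrier_root k, ← hx, carrier_of_pos k hfree]
  | step x hzero ih =>
    have hadj := adj_parent (Index.ne_root_of_at_eq_zero hzero)
    rw [ih ((carrier_parent k hzero).trans hx)] at hadj
    exact absurd hzero (hpos x hadj).ne'

theorem contractZero_color_root (hk : k.EssentiallyPositive)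
    (hroot : X.color X.root = 0 → ∀ w, X.graph.Adj w X.root → 0 < k.at w) :
    (contractZero k).color (contractZero k).root = X.color X.root := by
  by_cases h : X.color X.root = 0
  · exact congrArg X.color (eq_root_of_carrier_eq (hroot h) (carrier_representative _))
  · exact (((isContraction_contractZero hk).color_eq_zero_or_eq X.root).resolve_left h).symm

theorem ncard_children_contractZero_root (hdeg : X.deg X.root = 1)
    (hpos : ∀ w, X.graph.Adj w X.root → 0 < k.at w) :
    ((contractZero k).children (contractZero k).root).ncard = 1 := by
  rw [deg_root] at hdeg
  obtain ⟨w, hw⟩ := Set.ncard_eq_one.1 hdeg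
  have hmem {y : X.V} : y ∈ X.parentMap.children X.root ↔ y = w := by rw [hw]; rfl
  obtain ⟨hne, hparent⟩ := hmem.2 rfl
  have hadj : X.graph.Adj w X.root := (adj_iff.2 (Or.inl ⟨hne, hparent⟩)).symm
  refine Set.ncard_eq_one.2 ⟨⟨w, hpos w hadj⟩, Set.ext fun y => ?_⟩
  rw [mem_children_contractZero, Set.mem_singleton_iff, Subtype.ext_iff (a2 := ⟨w, _⟩)]
  refine ⟨fun h => hmem.1 ⟨h.1, eq_root_of_carrier_eq hpos h.2⟩, fun h => ?_⟩
  rw [h]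
  exact ⟨hne, congrArg (carrier k) hparent⟩

theorem contractZero_color_ne_source_of_leaf (hX : X.Admissible γ)
    (hk : k.EssentiallyPositive)
    (hconv : γ 0 ≠ 0 → ∀ v, X.color v = LaurentPoly.const r (γ 0) →
      ∃ w, w ≠ X.root ∧ 0 < k.at w ∧ carrier k (X.parent w) = carrier k v)
    {v : FreeVertex k} (hv : (contractZero k).children v = ∅) :
    (contractZero k).color v ≠ LaurentPoly.const r (γ 0) := by
  intro hcolor
  by_cases h0 : γ 0 = 0
  · obtain ⟨x, hx, hleaf⟩ := exists_leaf_of_contractZero_leaf hv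
    have hxcolor : X.color x = LaurentPoly.const r (γ 0) := by
      rcases (isContraction_contractZero hk).color_eq_zero_or_eq x with h | h
      · rw [h, LaurentPoly.const_eq_zero.2 h0]
      · rw [h, hx, hcolor]
    exact (children_nonempty_of_one_lt_deg (hX.1 x hxcolor)).ne_empty hleaf
  · obtain ⟨w, hne, hpos, hw⟩ := hconv h0 (representative v) hcolor
    rw [carrier_representative] at hw
    have hchild : ⟨w, hpos⟩ ∈ (contractZero k).children v :=
      mem_children_contractZero.2 ⟨hne, hw⟩
    exact hv.le hchild

theorem admissible_contractZero (hX : X.Admissible γ) (hk : k.EssentiallyPositive)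
    (hroot : X.color X.root = 0 → X.deg X.root = 1 ∧ ∀ w, X.graph.Adj w X.root → 0 < k.at w)
    (hsingle : γ 0 = 0 → Nontrivial X.V)
    (hconv : γ 0 ≠ 0 → ∀ v, X.color v = LaurentPoly.const r (γ 0) →
      ∃ w, w ≠ X.root ∧ 0 < k.at w ∧ carrier k (X.parent w) = carrier k v) :
    (contractZero k).Admissible D γ := by
  have hcolor := contractZero_color_root hk fun h => (hroot h).2
  exact
  { color_mem := fun v => Or.inr (X.color_mem _)
    leaf := fun v => contractZero_color_ne_source_of_leaf hX hk hconv
    root_ne_source := hcolor ▸ hX.2.1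
    root_ne_target := hcolor ▸ hX.2.2
    root_zero := fun h => by
      obtain ⟨hdeg, hpos⟩ := hroot (hcolor.symm.trans h)
      exact ncard_children_contractZero_root hdeg hpos
    root_child := fun h0 => by
      have := hsingle h0
      by_contra hempty
      obtain ⟨x, hx, hleaf⟩ :=
        exists_leaf_of_contractZero_leaf (Set.not_nonempty_iff_eq_empty.1 hempty)
      have hzero : LaurentPoly.const r (γ 0) = 0 := LaurentPoly.const_eq_zero.2 h0
      have hxcolor : X.color x ≠ 0 := fun h =>
        (children_nonempty_of_one_lt_deg (hX.1 x (h.trans hzero.symm))).ne_empty hleaf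
      have hrootcolor : X.color X.root ≠ 0 := hzero ▸ hX.2.1
      obtain rfl := hk.eq_of_carrier_eq hxcolor hrootcolor hx
      exact children_root_nonempty.ne_empty hleaf }

end ColoredTree

namespace ParentMap

variable {V : Type*} (T : ParentMap V) (P : V → Prop)

open Classical in
/-- The place to which the children of `v` move when every `v` with `P v` gets a new child
`Sum.inr v`. -/
def lower (v : V) : V ⊕ {v // P v} := if h : P v then .inr ⟨v, h⟩ else .inl v

open Classical in
/-- The tree in which a new vertex `Sum.inr v` is inserted between every `v` with `P v` and the
children of `v`. -/
@[simps root]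
def insertBelow : ParentMap (V ⊕ {v // P v}) where
  root := .inl T.root
  parent := Sum.elim (fun v => if v = T.root then .inl v else lower P (T.parent v))
    fun v => .inl v.1
  parent_root := if_pos rfl
  exists_height := by
    obtain ⟨h, hh⟩ := T.exists_height
    refine ⟨Sum.elim (fun v => 2 * h v) fun w => 2 * h w + 1, ?_⟩
    rintro (v | v) hv
    · have hv : v ≠ T.root := fun h => hv (congrArg _ h)
      have := hh v hv
      simp only [Sum.elim_inl, if_neg hv, lower]
      split_ifs <;> simp only [Sum.elim_inl, Sum.elim_inr] <;> omega
    · exact Nat.lt_succ_self _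

variable {T P}

theorem elim_lower (v : V) : Sum.elim id Subtype.val (lower P v) = v := by
  unfold lower
  split_ifs <;> rfl

theorem lower_injective : Function.Injective (lower P) :=
  Function.LeftInverse.injective (g := Sum.elim id Subtype.val) elim_lower

theorem insertBelow_parent_inl {v : V} (hv : v ≠ T.root) :
    (T.insertBelow P).parent (.inl v) = lower P (T.parent v) := if_neg hv

theorem inl_mem_children_insertBelow {v : V} {x : V ⊕ {v // P v}} :
    .inl v ∈ (T.insertBelow P).children x ↔ v ≠ T.root ∧ lower P (T.parent v) = x := by
  constructor
  · rintro ⟨hv, hx⟩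
    have hv : v ≠ T.root := fun h => hv (congrArg _ h)
    exact ⟨hv, insertBelow_parent_inl hv ▸ hx⟩
  · rintro ⟨hv, hx⟩
    exact ⟨Sum.inl_injective.ne hv, (insertBelow_parent_inl hv).trans hx⟩

theorem inr_mem_children_insertBelow {v : {v // P v}} {x : V ⊕ {v // P v}} :
    .inr v ∈ (T.insertBelow P).children x ↔ .inl v.1 = x :=
  and_iff_right Sum.inr_ne_inl

theorem children_insertBelow_lower (v : V) :
    (T.insertBelow P).children (lower P v) = Sum.inl '' T.children v := by
  ext (w | w)
  · rw [inl_mem_children_insertBelow, Sum.inl_injective.mem_set_image, lower_injective.eq_iff]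
    rfl
  · rw [inr_mem_children_insertBelow]
    refine iff_of_false (fun h => ?_) (by simp)
    unfold lower at h
    split_ifs at h with hv
    exact hv (Sum.inl_injective h ▸ w.2)

theorem children_insertBelow_inl {v : V} (hv : P v) :
    (T.insertBelow P).children (.inl v) = {.inr ⟨v, hv⟩} := by
  ext (w | w)
  · rw [inl_mem_children_insertBelow]
    refine iff_of_false (fun ⟨_, h⟩ => ?_) (by simp)
    unfold lower at h
    split_ifs at h with hw
    exact hw (Sum.inl_injective h ▸ hv)
  · rw [inr_mem_children_insertBelow, Sum.inl_injective.eq_iff, Set.mem_singleton_iff,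
      Sum.inr_injective.eq_iff, Subtype.ext_iff]

theorem ncard_children_insertBelow_lower (v : V) :
    ((T.insertBelow P).children (lower P v)).ncard = (T.children v).ncard := by
  rw [children_insertBelow_lower, Set.ncard_image_of_injective _ Sum.inl_injective]

theorem ncard_children_insertBelow_inr (v : {v // P v}) :
    ((T.insertBelow P).children (.inr v)).ncard = (T.children v.1).ncard := by
  rw [← ncard_children_insertBelow_lower (P := P), lower, dif_pos v.2]

theorem ncard_children_insertBelow_inl [DecidablePred P] (v : V) :
    ((T.insertBelow P).children (.inl v)).ncard = if P v then 1 else (T.children v).ncard := by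
  split_ifs with hv
  · rw [children_insertBelow_inl hv, Set.ncard_singleton]
  · rw [← ncard_children_insertBelow_lower (P := P), lower, dif_neg hv]

end ParentMap

namespace PosTree

open ColoredTree

variable {r : ℕ} {V : Type u} {D : Set (LaurentPoly r)} {γ : ℝ → ℂ} (N : PosTree r V)

/-- The color of a vertex of the tree `N.insertBelow P`, whose new vertices have color zero. -/
def insertBelowColor (P : V → Prop) : V ⊕ {v // P v} → LaurentPoly r :=
  Sum.elim N.color fun _ => 0

/-- The index of the parent edge of a vertex of the tree `N.insertBelow P`, where the parent edges
of the new vertices have index zero. -/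
def insertBelowIdx (P : V → Prop) : V ⊕ {v // P v} → ℕ := Sum.elim N.idx fun _ => 0

variable {N} in
theorem Admissible.insertBelowColor_mem (hN : N.Admissible D γ) {P : V → Prop}
    (x : V ⊕ {v // P v}) : N.insertBelowColor P x ∈ insert 0 D := by
  rcases x with v | _
  · exact hN.color_mem v
  · exact Set.mem_insert _ _

theorem isContraction_insertBelow {P : V → Prop} [Fintype (V ⊕ {v // P v})]
    (hcolor : ∀ x, N.insertBelowColor P x ∈ D)
    {l : (ofParentMap (N.insertBelow P) hcolor).Index} (hl : l.at = N.insertBelowIdx P) :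
    IsContraction l N (Sum.elim id Subtype.val) := by
  have hfree (v : V) : 0 < l.at (.inl v) := by rw [hl]; exact N.idx_pos v
  have hnew (w : {v // P v}) : l.at (.inr w) = 0 := by rw [hl]; rfl
  have hparent (x : V ⊕ {v // P v}) :
      (ofParentMap (N.insertBelow P) hcolor).parent x = (N.insertBelow P).parent x :=
    congrFun (congrArg ParentMap.parent (parentMap_ofParentMap _ hcolor)) x
  refine ⟨⟨?_, fun v => ⟨⟨.inl v, hfree v⟩, rfl⟩⟩, rfl, ?_, ?_, ?_, fun v => ⟨.inl v, rfl, rfl, ?_⟩⟩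
  · rintro ⟨v | v, hv⟩ ⟨w | w, hw⟩ h
    · exact Subtype.ext (congrArg Sum.inl h)
    · exact absurd hw (hnew w).not_gt
    · exact absurd hv (hnew v).not_gt
    · exact absurd hv (hnew v).not_gt
  · rintro (v | v) hv
    · rw [hparent]
      rcases eq_or_ne v N.root with rfl | hroot
      · rw [← ParentMap.insertBelow_root, ParentMap.parent_root]
        exact N.parent_root.symm
      · rw [ParentMap.insertBelow_parent_inl hroot, ParentMap.elim_lower]
        rfl
    · exact absurd hv (hnew v).not_gt
  · rintro (v | v) hv
    · exact absurd hv (hfree v).ne'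
    · rw [hparent]
      rfl
  · rintro (v | v) hv
    · rw [hl]
      rfl
    · exact absurd hv (hnew v).not_gt
  · rintro (w | w) hne h
    · exact absurd (congrArg Sum.inl h) hne
    · rfl

/-- The vertices of non-zero color that get a new child of color zero in order to make the tree
harvestable: those with several children, and the root if it has none. -/
def NeedsHub (v : V) : Prop :=
  N.color v ≠ 0 ∧ (2 ≤ (N.children v).ncard ∨ v = N.root ∧ N.children v = ∅)

variable {N}

theorem ncard_children_le_one_of_not_needsHub {v : V} (hcolor : N.color v ≠ 0)
    (hv : ¬ N.NeedsHub v) : (N.children v).ncard ≤ 1 := by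
  by_contra h
  exact hv ⟨hcolor, Or.inl (not_le.1 h)⟩

variable [Fintype V]

namespace Admissible

section HubTree

variable [DecidablePred N.NeedsHub] (hN : N.Admissible D γ)

/-- The colored tree in which every vertex that needs it has a new child of color zero. -/
abbrev hubTree : ColoredTree.{u} (insert 0 D) :=
  ofParentMap (N.insertBelow N.NeedsHub) hN.insertBelowColor_mem

theorem deg_hubTree_inr (v : {v // N.NeedsHub v}) :
    hN.hubTree.deg (.inr v : V ⊕ {v // N.NeedsHub v}) = (N.children v.1).ncard + 1 := by
  rw [deg_of_ne_root (X := hN.hubTree) Sum.inr_ne_inl, parentMap_ofParentMap,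
    ParentMap.ncard_children_insertBelow_inr]

theorem deg_hubTree_inl {v : V} (hv : v ≠ N.root) :
    hN.hubTree.deg (.inl v : V ⊕ {v // N.NeedsHub v}) =
      (if N.NeedsHub v then 1 else (N.children v).ncard) + 1 := by
  rw [deg_of_ne_root (X := hN.hubTree) (Sum.inl_injective.ne hv), parentMap_ofParentMap,
    ParentMap.ncard_children_insertBelow_inl]

theorem deg_hubTree_root : hN.hubTree.deg hN.hubTree.root = 1 := by
  rw [deg_root, parentMap_ofParentMap]
  refine (ParentMap.ncard_children_insertBelow_inl N.root).trans (ite_eq_left_iff.2 fun hv => ?_)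
  by_cases hcolor : N.color N.root = 0
  · exact hN.root_zero hcolor
  · have hnonempty : (N.children N.root).ncard ≠ 0 := by
      rw [Ne, Set.ncard_eq_zero]
      exact fun h => hv ⟨hcolor, Or.inr ⟨rfl, h⟩⟩
    have := ncard_children_le_one_of_not_needsHub hcolor hv
    omega

theorem admissible_hubTree : hN.hubTree.Admissible γ := by
  refine ⟨?_, hN.root_ne_source, hN.root_ne_target⟩
  rintro (v | v) hcolor
  · have hroot : v ≠ N.root := by
      rintro rfl
      exact hN.root_ne_source hcolor
    rw [deg_hubTree_inl hN hroot]
    have : (N.children v).ncard ≠ 0 := by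
      rw [Ne, Set.ncard_eq_zero]
      exact fun h => hN.leaf v h hcolor
    split_ifs <;> omega
  · have h0 : γ 0 = 0 := LaurentPoly.const_eq_zero.1 hcolor.symm
    rw [deg_hubTree_inr]
    rcases v.2.2 with h | ⟨hroot, hempty⟩
    · omega
    · exact absurd (hroot ▸ hempty) (hN.root_child h0).ne_empty

theorem deg_hubTree_le_two {x : hN.hubTree.V} (hx : hN.hubTree.color x ≠ 0) :
    hN.hubTree.deg x ≤ 2 := by
  rcases x with v | v
  · rcases eq_or_ne v N.root with rfl | hroot
    · exact hN.deg_hubTree_root.trans_le one_le_two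
    · rw [deg_hubTree_inl hN hroot]
      split_ifs with hv
      · rfl
      · exact Nat.succ_le_succ (ncard_children_le_one_of_not_needsHub hx hv)
  · exact absurd rfl hx

theorem deg_hubTree_ne_two
    (hreduced : ∀ v, v ≠ N.root → N.color v = 0 → (N.children v).ncard ≠ 1) {x : hN.hubTree.V}
    (hx : hN.hubTree.color x = 0) : hN.hubTree.deg x ≠ 2 := by
  rcases x with v | v
  · rcases eq_or_ne v N.root with rfl | hroot
    · exact hN.deg_hubTree_root.trans_ne (by decide)
    · rw [deg_hubTree_inl hN hroot, if_neg fun h => h.1 hx]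
      exact fun h => hreduced v hroot hx (Nat.succ_injective h)
  · rw [deg_hubTree_inr]
    rcases v.2.2 with h | ⟨-, h⟩
    · omega
    · rw [h, Set.ncard_empty]
      decide

theorem harvestable_hubTree
    (hreduced : ∀ v, v ≠ N.root → N.color v = 0 → (N.children v).ncard ≠ 1)
    {l : hN.hubTree.Index} (hl : l.at = N.insertBelowIdx N.NeedsHub) : Harvestable γ l where
  admissible := hN.admissible_hubTree
  deg_root := hN.deg_hubTree_root
  deg_of_ne_zero _ := hN.deg_hubTree_le_two
  deg_of_eq_zero _ := hN.deg_hubTree_ne_two hreduced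
  index x hx := by
    rw [hl] at hx
    rcases x with v | v
    · exact absurd hx (N.idx_pos v).ne'
    · refine ⟨rfl, ?_⟩
      rw [← parentMap_parent, parentMap_ofParentMap]
      exact v.2.1

end HubTree

variable {Γ : Type} [AddCommGroup Γ] [LinearOrder Γ] [IsOrderedAddMonoid Γ]

theorem exists_harvestable (hN : N.Admissible D γ)
    (hreduced : ∀ v, v ≠ N.root → N.color v = 0 → (N.children v).ncard ≠ 1)
    (mon : (Fin r → ℤ) ≃+ Γ) (hγ : ∀ t ∈ Set.Ioo (0 : ℝ) 1, γ t ≠ 0)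
    (hconv : N.Converges mon γ) :
    ∃ (Y : ColoredTree.{u} (insert 0 D)) (l : Y.Index), Harvestable γ l ∧
      ColoredTree.Converges mon γ l ∧ N.integral mon γ = iteratedIntegral mon γ l := by
  classical
  obtain ⟨l, hl⟩ := exists_index_at_eq (X := hN.hubTree) (f := N.insertBelowIdx N.NeedsHub)
    N.idx_root
  obtain ⟨hiff, hintegral⟩ := (N.isContraction_insertBelow hN.insertBelowColor_mem
    hl).converges_iff_and_iteratedIntegral_eq mon hγ
  exact ⟨hN.hubTree, l, hN.harvestable_hubTree hreduced hl, hiff.2 hconv, hintegral.symm⟩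

end Admissible

end PosTree

section CoefficientMap

variable {Γ : Type*} [AddCommGroup Γ] [LinearOrder Γ] [IsOrderedAddMonoid Γ] {R S : Type*}
  [CommRing R] [CommRing S]

/-- The homomorphism of rings of Hahn series that applies a ring homomorphism to each
coefficient. -/
def mapCoeff (f : R →+* S) : HahnSeries Γ R →+* HahnSeries Γ S where
  toFun x := x.map f
  map_one' := by
    ext g
    simp only [HahnSeries.map_coeff, HahnSeries.coeff_one]
    split_ifs <;> simp
  map_mul' x y := HahnSeries.map_mul (f : R →ₙ+* S)
  map_zero' := by ext; simp
  map_add' x y := by ext; simp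

theorem coeff_mapCoeff (f : R →+* S) (x : HahnSeries Γ R) (g : Γ) :
    (mapCoeff f x).coeff g = f (x.coeff g) := rfl

theorem mapCoeff_C (f : R →+* S) (a : R) :
    mapCoeff f (HahnSeries.C a : HahnSeries Γ R) = HahnSeries.C (f a) :=
  HahnSeries.map_single (f : ZeroHom R S)

theorem mapCoeff_mapCoeff {Q : Type*} [CommRing Q] (f : R →+* S) (g : S →+* Q)
    (x : HahnSeries Γ R) : mapCoeff g (mapCoeff f x) = mapCoeff (g.comp f) x := rfl

theorem isUnit_hahnSeries_of_isUnit_coeff {x : HahnSeries Γ R} {g : Γ}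
    (hlt : ∀ h < g, x.coeff h = 0) (hg : IsUnit (x.coeff g)) : IsUnit x := by
  nontriviality R
  have horder : x.order = g := le_antisymm (HahnSeries.order_le_of_coeff_ne_zero hg.ne_zero)
    (not_lt.1 fun h => HahnSeries.coeff_order_eq_zero.not.2
      (HahnSeries.ne_zero_of_coeff_ne_zero hg.ne_zero) (hlt _ h))
  refine HahnSeries.isUnit_of_isUnit_leadingCoeff_AddUnitOrder ?_ (AddGroup.isAddUnit _)
  rwa [HahnSeries.leadingCoeff_eq, horder]

end CoefficientMap

section FractionFamily

variable {r : ℕ} {Γ : Type} [AddCommGroup Γ] [LinearOrder Γ] [IsOrderedAddMonoid Γ]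
  (mon : (Fin r → ℤ) ≃+ Γ) {T : Type*} [TopologicalSpace T] (z : C(T, ℂ)) {a : LaurentPoly r}

omit [IsOrderedAddMonoid Γ] in
theorem coeff_expand (a : LaurentPoly r) (m : Fin r → ℤ) :
    (expand mon a).coeff (mon m) = a.coeff m := by
  classical
  rw [expand, Finsupp.sum, HahnSeries.coeff_sum]
  simp only [HahnSeries.coeff_single, EmbeddingLike.apply_eq_iff_eq, Finset.sum_ite_eq]
  exact ite_eq_left_iff.2 fun h => (Finsupp.notMem_support_iff.1 h).symm

theorem isUnit_sub_expand
    (ha : (∃ m, mon m < 0 ∧ a.coeff m ≠ 0) ∨ ∀ t, z t ≠ a.coeff 0) :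
    IsUnit (HahnSeries.C z - mapCoeff (algebraMap ℂ C(T, ℂ)) (expand mon a)) := by
  have coeff_C {g : Γ} (hg : g < 0) : (HahnSeries.C z : HahnSeries Γ C(T, ℂ)).coeff g = 0 :=
    HahnSeries.coeff_single_of_ne hg.ne
  by_cases hneg : ∃ m, mon m < 0 ∧ a.coeff m ≠ 0
  · obtain ⟨m, hm, ham⟩ := hneg
    rw [← coeff_expand mon] at ham
    have horder : (expand mon a).order < 0 :=
      (HahnSeries.order_le_of_coeff_ne_zero ham).trans_lt hm
    refine isUnit_hahnSeries_of_isUnit_coeff (g := (expand mon a).order) (fun g hg => ?_) ?_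
    · rw [HahnSeries.coeff_sub, coeff_C (hg.trans horder), coeff_mapCoeff,
        HahnSeries.coeff_eq_zero_of_lt_order hg, map_zero, sub_zero]
    · rw [HahnSeries.coeff_sub, coeff_C horder, coeff_mapCoeff, zero_sub]
      exact ((isUnit_iff_ne_zero.2 (HahnSeries.coeff_order_eq_zero.not.2
        (HahnSeries.ne_zero_of_coeff_ne_zero ham))).map (algebraMap ℂ C(T, ℂ))).neg
  · have coeff_expand_zero : (expand mon a).coeff 0 = a.coeff 0 := by
      simpa only [map_zero] using coeff_expand mon a 0
    refine isUnit_hahnSeries_of_isUnit_coeff (g := 0) (fun g hg => ?_) ?_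
    · obtain ⟨m, rfl⟩ := mon.surjective g
      rw [HahnSeries.coeff_sub, coeff_C hg, coeff_mapCoeff, coeff_expand,
        not_not.1 fun h => hneg ⟨m, hg, h⟩, map_zero, sub_zero]
    · rw [HahnSeries.coeff_sub, HahnSeries.C_apply, HahnSeries.coeff_single_same,
        coeff_mapCoeff, coeff_expand_zero, ContinuousMap.isUnit_iff_forall_ne_zero]
      exact fun t => sub_ne_zero.2 (ha.resolve_left hneg t)

theorem exists_mapCoeff_eval_eq_fraction
    (ha : (∃ m, mon m < 0 ∧ a.coeff m ≠ 0) ∨ ∀ t, z t ≠ a.coeff 0) :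
    ∃ F : HahnSeries Γ C(T, ℂ), ∀ t,
      mapCoeff (ContinuousMap.evalAlgHom ℂ ℂ t : C(T, ℂ) →+* ℂ) F = fraction mon (z t) a := by
  obtain ⟨F, hF⟩ := (isUnit_sub_expand mon z ha).exists_left_inv
  refine ⟨F, fun t => eq_inv_of_mul_eq_one_left ?_⟩
  have heval := congrArg (mapCoeff (ContinuousMap.evalAlgHom ℂ ℂ t : C(T, ℂ) →+* ℂ)) hF
  rwa [map_mul, map_sub, map_one, mapCoeff_C, mapCoeff_mapCoeff] at heval

open Classical in
/-- The factor of `1 / (z - a)` that can have a pole along the path: all of it if `a` is constant,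
and `1` otherwise. -/
def pole (a : LaurentPoly r) (z : ℂ) : ℂ :=
  if a = LaurentPoly.const r (a.coeff 0) then (z - a.coeff 0)⁻¹ else 1

theorem pole_const (c z : ℂ) : pole (LaurentPoly.const r c) z = (z - c)⁻¹ := by
  have hc : (LaurentPoly.const r c).coeff 0 = c := by
    rw [LaurentPoly.const, AddMonoidAlgebra.coe_algebraMap]
    simp
  rw [pole, hc, if_pos rfl]

theorem pole_of_ne_const (h : ∀ c, a ≠ LaurentPoly.const r c) (z : ℂ) : pole a z = 1 :=
  if_neg (h _)

theorem exists_pole_smul_mapCoeff_eval_eq_fraction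
    (ha : (∀ c, a ≠ LaurentPoly.const r c) →
      (∃ m, mon m < 0 ∧ a.coeff m ≠ 0) ∨ ∀ t, z t ≠ a.coeff 0) :
    ∃ F : HahnSeries Γ C(T, ℂ), ∀ t, fraction mon (z t) a =
      pole a (z t) • mapCoeff (ContinuousMap.evalAlgHom ℂ ℂ t : C(T, ℂ) →+* ℂ) F := by
  by_cases h : ∃ c, a = LaurentPoly.const r c
  · obtain ⟨c, rfl⟩ := h
    refine ⟨1, fun t => ?_⟩
    rw [fraction_const, pole_const, map_one, ← HahnSeries.C_mul_eq_smul, mul_one]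
  · obtain ⟨F, hF⟩ := exists_mapCoeff_eval_eq_fraction mon z (ha (not_exists.1 h))
    exact ⟨F, fun t => by rw [hF, pole_of_ne_const (not_exists.1 h), one_smul]⟩

theorem exists_coeff_prod_fraction_eq {V : Type*} [Fintype V] (c : V → LaurentPoly r)
    (hc : ∀ v, (∀ w, c v ≠ LaurentPoly.const r w) →
      (∃ m, mon m < 0 ∧ (c v).coeff m ≠ 0) ∨ ∀ t, z t ≠ (c v).coeff 0) (g : Γ) :
    ∃ q : C(V → T, ℂ), ∀ s : V → T,
      (∏ v, fraction mon (z (s v)) (c v)).coeff g = (∏ v, pole (c v) (z (s v))) * q s := by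
  choose F hF using fun v => exists_pole_smul_mapCoeff_eval_eq_fraction mon z (hc v)
  let pullback (v : V) : C(T, ℂ) →+* C(V → T, ℂ) :=
    ContinuousMap.compRightAlgHom ℂ ℂ
      (⟨fun s => s v, continuous_apply v⟩ : C(V → T, T))
  refine ⟨(∏ v, mapCoeff (pullback v) (F v)).coeff g, fun s => ?_⟩
  have heval : mapCoeff (ContinuousMap.evalAlgHom ℂ ℂ s : C(V → T, ℂ) →+* ℂ)
      (∏ v, mapCoeff (pullback v) (F v)) =
        ∏ v, mapCoeff (ContinuousMap.evalAlgHom ℂ ℂ (s v) : C(T, ℂ) →+* ℂ) (F v) :=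
    map_prod _ _ _
  simp only [hF]
  rw [prod_smul_hahnSeries, HahnSeries.coeff_smul, smul_eq_mul, ← heval, coeff_mapCoeff]
  rfl

end FractionFamily

section BetaIntegral

variable {𝕜 : Type*} [RCLike 𝕜]

theorem hasDerivAt_inv_factorial_mul_pow {G : ℝ → 𝕜} {g : 𝕜} {u : ℝ} (h : HasDerivAt G g u)
    (n : ℕ) :
    HasDerivAt (fun u => ((n + 1).factorial : 𝕜)⁻¹ * G u ^ (n + 1))
      ((n.factorial : 𝕜)⁻¹ * G u ^ n * g) u := by
  convert! (h.pow (n + 1)).const_mul ((n + 1).factorial : 𝕜)⁻¹ using 1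
  have hn : (n : 𝕜) + 1 ≠ 0 := by exact_mod_cast n.succ_ne_zero
  rw [Nat.factorial_succ, add_tsub_cancel_right]
  push_cast
  field_simp

variable {G g : ℝ → 𝕜} {x y : ℝ} {B : Set ℝ}

theorem intervalIntegrable_beta (hxy : x ≤ y) (hG : ContinuousOn G (Set.Icc x y))
    (hg : IntervalIntegrable g volume x y) (a b : ℕ) :
    IntervalIntegrable (fun u => ((a.factorial : 𝕜)⁻¹ * (G y - G u) ^ a) *
      ((b.factorial : 𝕜)⁻¹ * G u ^ b) * g u) volume x y := by
  rw [← Set.uIcc_of_le hxy] at hG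
  exact hg.continuousOn_mul (by fun_prop)

theorem integral_beta_succ (hxy : x ≤ y) (hB : B.Countable) (hG : ContinuousOn G (Set.Icc x y))
    (hderiv : ∀ u ∈ Set.Ioo x y \ B, HasDerivAt G (g u) u)
    (hg : IntervalIntegrable g volume x y) (hx : G x = 0) (a b : ℕ) :
    ∫ u in x..y, (((a + 1).factorial : 𝕜)⁻¹ * (G y - G u) ^ (a + 1)) *
        ((b.factorial : 𝕜)⁻¹ * G u ^ b) * g u =
      ∫ u in x..y, ((a.factorial : 𝕜)⁻¹ * (G y - G u) ^ a) *
        (((b + 1).factorial : 𝕜)⁻¹ * G u ^ (b + 1)) * g u := by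
  have hint := intervalIntegrable_beta hxy hG hg
  rw [← sub_eq_zero, ← intervalIntegral.integral_sub (hint (a + 1) b) (hint a (b + 1)),
    integral_eq_of_hasDerivAt_off_countable_of_le
      (fun u => (((a + 1).factorial : 𝕜)⁻¹ * (G y - G u) ^ (a + 1)) *
        (((b + 1).factorial : 𝕜)⁻¹ * G u ^ (b + 1)))
      _ hxy hB (by fun_prop) (fun u hu => ?_) ((hint (a + 1) b).sub (hint a (b + 1)))]
  · simp [hx]
  · convert! (hasDerivAt_inv_factorial_mul_pow ((hderiv u hu).const_sub (G y)) a).mul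
      (hasDerivAt_inv_factorial_mul_pow (hderiv u hu) b) using 1
    ring

theorem integral_beta (hxy : x ≤ y) (hB : B.Countable) (hG : ContinuousOn G (Set.Icc x y))
    (hderiv : ∀ u ∈ Set.Ioo x y \ B, HasDerivAt G (g u) u)
    (hg : IntervalIntegrable g volume x y) (hx : G x = 0) (a b : ℕ) :
    ∫ u in x..y, ((a.factorial : 𝕜)⁻¹ * (G y - G u) ^ a) *
        ((b.factorial : 𝕜)⁻¹ * G u ^ b) * g u =
      ((a + b + 1).factorial : 𝕜)⁻¹ * G y ^ (a + b + 1) := by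
  induction a generalizing b with
  | zero =>
    have hint := intervalIntegrable_beta hxy hG hg 0 b
    simp only [Nat.factorial_zero, Nat.cast_one, inv_one, pow_zero, one_mul] at hint ⊢
    rw [integral_eq_of_hasDerivAt_off_countable_of_le
      (fun u => ((b + 1).factorial : 𝕜)⁻¹ * G u ^ (b + 1)) _ hxy hB (by fun_prop)
      (fun u hu => hasDerivAt_inv_factorial_mul_pow (hderiv u hu) b) hint]
    simp [hx]
  | succ a ih =>
    rw [integral_beta_succ hxy hB hG hderiv hg hx, ih (b + 1), add_right_comm a 1 b, add_assoc a b]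

end BetaIntegral

section Asymptotics

theorem isBigO_principal_of_isCompact {X E F : Type*} [TopologicalSpace X] [Norm E]
    [SeminormedAddCommGroup F] {f : X → E} {g : X → F} {K S : Set X} (hK : IsCompact K)
    (hSK : S ⊆ K) (h : ∀ x ∈ K, f =O[𝓝[S] x] g) : f =O[𝓟 S] g := by
  have hcover : f =O[𝓟 (K ∩ S)] g := by
    refine hK.induction_on (p := fun A => f =O[𝓟 (A ∩ S)] g) ?_ ?_ ?_ fun x hx => ?_
    · simp
    · exact fun A A' hA h' => h'.mono (principal_mono.2 (Set.inter_subset_inter_left S hA))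
    · intro A A' hA hA'
      rw [Set.union_inter_distrib_right, ← sup_principal]
      exact hA.sup hA'
    · obtain ⟨C, hC⟩ := (h x hx).bound
      obtain ⟨U, hU, hUC⟩ := mem_nhdsWithin_iff_exists_mem_nhds_inter.1 hC
      exact ⟨U, mem_nhdsWithin_of_mem_nhds hU, .of_bound C fun y hy => hUC hy⟩
  rwa [Set.inter_eq_right.2 hSK] at hcover

theorem induction_on_intervals_off_finset {P : ℝ → ℝ → Prop}
    (glue : ∀ a s b, a < s → s < b → P a s → P s b → P a b) (B : Finset ℝ) {a b : ℝ} (hab : a < b)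
    (h : ∀ a' b', a ≤ a' → a' < b' → b' ≤ b → (∀ s ∈ B, s ∉ Set.Ioo a' b') → P a' b') :
    P a b := by
  induction B using Finset.induction_on generalizing a b with
  | empty => exact h a b le_rfl hab le_rfl (by simp)
  | insert s B _ ih =>
    by_cases hs : s ∈ Set.Ioo a b
    · refine glue a s b hs.1 hs.2 (ih hs.1 fun a' b' ha hlt hb hB => ?_)
        (ih hs.2 fun a' b' ha hlt hb hB => ?_)
      · exact h a' b' ha hlt (hb.trans hs.2.le)
          ((Finset.forall_mem_insert _ _ _).2 ⟨fun hmem => hmem.2.not_ge hb, hB⟩)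
      · exact h a' b' (hs.1.le.trans ha) hlt hb
          ((Finset.forall_mem_insert _ _ _).2 ⟨fun hmem => hmem.1.not_ge ha, hB⟩)
    · exact ih hab fun a' b' ha hlt hb hB => h a' b' ha hlt hb
        ((Finset.forall_mem_insert _ _ _).2 ⟨fun hmem => hs (Set.Ioo_subset_Ioo ha hb hmem), hB⟩)

end Asymptotics

section Paths

variable {γ : ℝ → ℂ}

theorem PiecewiseSmooth.exists_finset (h : PiecewiseSmooth γ) :
    ∃ B : Finset ℝ, ∀ t ∈ Set.Ioo (0 : ℝ) 1 \ B,
      DifferentiableAt ℝ γ t ∧ ContinuousAt (deriv γ) t := by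
  obtain ⟨-, B, hB⟩ := h
  refine ⟨B, fun t ht => ?_⟩
  have hopen : IsOpen (Set.Ioo (0 : ℝ) 1 \ B) := isOpen_Ioo.sdiff B.finite_toSet.isClosed
  obtain ⟨a, b, htab, hsub⟩ := mem_nhds_iff_exists_Ioo_subset.1 (hopen.mem_nhds ht)
  have hab := htab.1.trans htab.2
  have hIcc : Set.Icc a b ⊆ Set.Icc 0 1 := by
    rw [← closure_Ioo hab.ne]
    exact closure_minimal (fun u hu => Set.Ioo_subset_Icc_self (hsub hu).1) isClosed_Icc
  have hsmooth := (hB a b (hIcc (Set.left_mem_Icc.2 hab.le)).1 hab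
    (hIcc (Set.right_mem_Icc.2 hab.le)).2 fun s hs hs' => (hsub hs').2 hs).mono
      Set.Ioo_subset_Icc_self
  have hnhds := Ioo_mem_nhds htab.1 htab.2
  exact ⟨(hsmooth.contDiffAt hnhds).differentiableAt (by simp),
    (hsmooth.continuousOn_deriv_of_isOpen isOpen_Ioo (by simp)).continuousAt hnhds⟩

theorem isBigO_deriv_of_contDiffOn {a b : ℝ} (hab : a < b)
    (h : ContDiffOn ℝ ∞ γ (Set.Icc a b)) : deriv γ =O[𝓟 (Set.Ioo a b)] (1 : ℝ → ℝ) := by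
  obtain ⟨C, hC⟩ := isCompact_Icc.exists_bound_of_continuousOn
    (h.continuousOn_derivWithin (uniqueDiffOn_Icc hab) (by simp))
  refine .of_bound C fun t ht => ?_
  rw [Set.mem_ofPred_eq, Pi.one_apply, norm_one, mul_one,
    ← derivWithin_of_mem_nhds (Icc_mem_nhds ht.1 ht.2)]
  exact hC t (Set.Ioo_subset_Icc_self ht)

theorem PiecewiseSmooth.isBigO_deriv (h : PiecewiseSmooth γ) :
    deriv γ =O[𝓟 (Set.Ioo 0 1)] (1 : ℝ → ℝ) := by
  obtain ⟨-, B, hB⟩ := h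
  refine induction_on_intervals_off_finset (fun a s b has hsb hleft hright => ?_) B zero_lt_one
    fun a b ha hab hb hdisj => isBigO_deriv_of_contDiffOn hab (hB a b ha hab hb hdisj)
  have hsplit : Set.Ioo a b = Set.Ioo a s ∪ {s} ∪ Set.Ioo s b := by
    rw [Set.Ioo_union_right has, Set.Ioc_union_Ioo_eq_Ioo has.le hsb]
  have hpoint : deriv γ =O[𝓟 {s}] (1 : ℝ → ℝ) := by simp
  rw [hsplit, ← sup_principal, ← sup_principal]
  exact (hleft.sup hpoint).sup hright

theorem one_le_inv_of_mem_Ioo {t : ℝ} (ht : t ∈ Set.Ioo (0 : ℝ) 1) : 1 ≤ t⁻¹ :=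
  (one_le_inv₀ ht.1).2 ht.2.le

theorem one_le_inv_pow_of_mem_Ioo {t : ℝ} (ht : t ∈ Set.Ioo (0 : ℝ) 1) (n : ℕ) : 1 ≤ t⁻¹ ^ n :=
  one_le_pow₀ (one_le_inv_of_mem_Ioo ht)

theorem one_le_inv_pow_mul_inv_one_sub_pow {t : ℝ} (ht : t ∈ Set.Ioo (0 : ℝ) 1) (a b : ℕ) :
    1 ≤ t⁻¹ ^ a * (1 - t)⁻¹ ^ b :=
  one_le_mul_of_one_le_of_one_le (one_le_inv_pow_of_mem_Ioo ht a)
    (one_le_inv_pow_of_mem_Ioo (Set.Ioo.one_sub_mem ht) b)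

theorem PiecewiseSmooth.intervalIntegrable_deriv (h : PiecewiseSmooth γ) {x y : ℝ}
    (hx : x ∈ Set.Icc (0 : ℝ) 1) (hy : y ∈ Set.Icc (0 : ℝ) 1) :
    IntervalIntegrable (deriv γ) volume x y := by
  obtain ⟨C, hC⟩ := Asymptotics.isBigO_principal.1 h.isBigO_deriv
  have hunit : IntervalIntegrable (deriv γ) volume 0 1 := by
    rw [intervalIntegrable_iff_integrableOn_Ioo_of_le zero_le_one]
    exact .of_bound (by simp) (measurable_deriv γ).aestronglyMeasurable (C * ‖(1 : ℝ)‖)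
      (ae_restrict_of_forall_mem measurableSet_Ioo hC)
  refine hunit.mono_set (Set.uIcc_subset_uIcc ?_ ?_) <;> rwa [Set.uIcc_of_le zero_le_one]

section Logarithm

variable (hγ : PiecewiseSmooth γ) (h0 : ∀ t ∈ Set.Ioo (0 : ℝ) 1, γ t ≠ 0) {x y : ℝ}
  (hx : x ∈ Set.Ioo (0 : ℝ) 1)
include hγ h0

theorem aestronglyMeasurable_logDeriv :
    AEStronglyMeasurable (fun u => deriv γ u / γ u) (volume.restrict (Set.Ioo 0 1)) := by
  simp only [div_eq_mul_inv]
  exact (measurable_deriv γ).aestronglyMeasurable.mul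
    (((hγ.1.mono Set.Ioo_subset_Icc_self).inv₀ h0).aestronglyMeasurable measurableSet_Ioo)

include hx

theorem intervalIntegrable_logDeriv (hy : y ∈ Set.Ioo (0 : ℝ) 1) :
    IntervalIntegrable (fun u => deriv γ u / γ u) volume x y := by
  have hsub : Set.uIcc x y ⊆ Set.Ioo 0 1 := Set.ordConnected_Ioo.uIcc_subset hx hy
  simp only [div_eq_mul_inv]
  exact (hγ.intervalIntegrable_deriv (Set.Ioo_subset_Icc_self hx)
    (Set.Ioo_subset_Icc_self hy)).mul_continuousOn
      ((hγ.1.mono (hsub.trans Set.Ioo_subset_Icc_self)).inv₀ fun t ht => h0 t (hsub ht))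

theorem logDiff_add_logDiff (hy : y ∈ Set.Ioo (0 : ℝ) 1) {z : ℝ} (hz : z ∈ Set.Ioo (0 : ℝ) 1) :
    logDiff γ x y + logDiff γ y z = logDiff γ x z :=
  intervalIntegral.integral_add_adjacent_intervals (intervalIntegrable_logDeriv hγ h0 hx hy)
    (intervalIntegrable_logDeriv hγ h0 hy hz)

theorem continuousOn_logDiff : ContinuousOn (logDiff γ x) (Set.Ioo 0 1) := by
  intro y hy
  obtain ⟨a, ha0, ha⟩ := exists_between (lt_min hx.1 hy.1)
  obtain ⟨b, hb, hb1⟩ := exists_between (max_lt hx.2 hy.2)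
  rw [lt_min_iff] at ha
  rw [max_lt_iff] at hb
  have hab : a ≤ b := (ha.1.trans hb.1).le
  have hcont := intervalIntegral.continuousOn_primitive_interval'
    (intervalIntegrable_logDeriv hγ h0 ⟨ha0, (ha.1.trans hx.2)⟩ ⟨hx.1.trans hb.1, hb1⟩)
    (a := x) (Set.uIcc_of_le hab ▸ ⟨ha.1.le, hb.1.le⟩)
  rw [Set.uIcc_of_le hab] at hcont
  exact (hcont.continuousAt (Icc_mem_nhds ha.2 hb.2)).continuousWithinAt

theorem hasDerivAt_logDiff (hy : y ∈ Set.Ioo (0 : ℝ) 1) (hdiff : DifferentiableAt ℝ γ y)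
    (hcont : ContinuousAt (deriv γ) y) : HasDerivAt (logDiff γ x) (deriv γ y / γ y) y :=
  intervalIntegral.integral_hasDerivAt_right (intervalIntegrable_logDeriv hγ h0 hx hy)
    ⟨_, Ioo_mem_nhds hy.1 hy.2, aestronglyMeasurable_logDeriv hγ h0⟩
    (hcont.div hdiff.continuousAt (h0 y hy))

theorem integral_logDiff_pow_mul_logDiff_pow (hxy : x ≤ y) (hy : y < 1) (a b : ℕ) :
    ∫ u in x..y, ((a.factorial : ℂ)⁻¹ * logDiff γ u y ^ a) *
        ((b.factorial : ℂ)⁻¹ * logDiff γ x u ^ b) * (deriv γ u / γ u) =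
      ((a + b + 1).factorial : ℂ)⁻¹ * logDiff γ x y ^ (a + b + 1) := by
  obtain ⟨B, hB⟩ := hγ.exists_finset
  have hy' : y ∈ Set.Ioo (0 : ℝ) 1 := ⟨hx.1.trans_le hxy, hy⟩
  have hsub : Set.Icc x y ⊆ Set.Ioo 0 1 := Set.ordConnected_Ioo.out hx hy'
  rw [← integral_beta hxy B.countable_toSet ((continuousOn_logDiff hγ h0 hx).mono hsub)
    (fun u hu => ?_) (intervalIntegrable_logDeriv hγ h0 hx hy') intervalIntegral.integral_same]
  · refine intervalIntegral.integral_congr fun u hu => ?_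
    rw [Set.uIcc_of_le hxy] at hu
    simp only [← logDiff_add_logDiff hγ h0 hx (hsub hu) hy', add_sub_cancel_left]
  · have hu' := hsub (Set.Ioo_subset_Icc_self hu.1)
    obtain ⟨hdiff, hcont⟩ := hB u ⟨hu', hu.2⟩
    exact hasDerivAt_logDiff hγ h0 hx hu' hdiff hcont

end Logarithm

namespace IsPathFromTo

variable {p q : TangentialBasePoint} {M : Set ℂ} (h : IsPathFromTo γ p q M)
include h

theorem isBigO_inv_sub_source : (fun t => (γ t - γ 0)⁻¹) =O[𝓝[>] 0] fun t : ℝ => t⁻¹ := by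
  have htangent := h.tangent_source
  rw [← h.source] at htangent
  refine (Asymptotics.isTheta_of_div_tendsto_nhds_ne_zero htangent p.vec_ne_zero).inv.2.trans
    (Asymptotics.isBigO_of_le _ fun t => ?_)
  rw [← Complex.ofReal_inv, Complex.norm_real]

theorem isBigO_inv_sub_target : (fun t => (γ t - γ 1)⁻¹) =O[𝓝[<] 1] fun t : ℝ => (1 - t)⁻¹ := by
  have htangent := h.tangent_target
  rw [← h.target] at htangent
  refine (Asymptotics.isTheta_of_div_tendsto_nhds_ne_zero htangent
    (neg_ne_zero.2 q.vec_ne_zero)).inv.2.trans (Asymptotics.isBigO_of_le _ fun t => ?_)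
  rw [norm_inv, norm_inv, norm_sub_rev, ← Complex.ofReal_one, ← Complex.ofReal_sub,
    Complex.norm_real]

theorem isBigO_inv_sub {c : ℂ} (hc : ∀ t ∈ Set.Ioo (0 : ℝ) 1, γ t ≠ c) {a b : ℕ}
    (ha : γ 0 = c → a ≠ 0) (hb : γ 1 = c → b ≠ 0) :
    (fun t => (γ t - c)⁻¹) =O[𝓟 (Set.Ioo 0 1)] fun t : ℝ => t⁻¹ ^ a * (1 - t)⁻¹ ^ b := by
  have isBigO_of_le {x : ℝ} {g : ℝ → ℝ}
      (hg : ∀ t ∈ Set.Ioo (0 : ℝ) 1, 0 ≤ g t ∧ g t ≤ t⁻¹ ^ a * (1 - t)⁻¹ ^ b) :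
      g =O[𝓝[Set.Ioo 0 1] x] fun t => t⁻¹ ^ a * (1 - t)⁻¹ ^ b := by
    refine .of_norm_eventuallyLE (eventually_mem_nhdsWithin.mono fun t ht => ?_)
    exact (Real.norm_of_nonneg (hg t ht).1).trans_le (hg t ht).2
  refine isBigO_principal_of_isCompact isCompact_Icc Set.Ioo_subset_Icc_self fun x hx => ?_
  by_cases hxc : γ x = c
  · have hendpoint : x = 0 ∨ x = 1 := by
      by_contra! hne
      exact hc x ⟨hx.1.lt_of_ne' hne.1, hx.2.lt_of_ne hne.2⟩ hxc
    rcases hendpoint with rfl | rfl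
    · refine ((hxc ▸ h.isBigO_inv_sub_source).mono
        (nhdsWithin_mono _ Set.Ioo_subset_Ioi_self)).trans (isBigO_of_le fun t ht => ?_)
      have hinv := one_le_inv_of_mem_Ioo ht
      exact ⟨by positivity, (le_self_pow₀ hinv (ha hxc)).trans (le_mul_of_one_le_right
        (by positivity) (one_le_inv_pow_of_mem_Ioo (Set.Ioo.one_sub_mem ht) b))⟩
    · refine ((hxc ▸ h.isBigO_inv_sub_target).mono
        (nhdsWithin_mono _ Set.Ioo_subset_Iio_self)).trans (isBigO_of_le fun t ht => ?_)
      have hinv := one_le_inv_of_mem_Ioo (Set.Ioo.one_sub_mem ht)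
      exact ⟨by positivity, (le_self_pow₀ hinv (hb hxc)).trans (le_mul_of_one_le_left
        (by positivity) (one_le_inv_pow_of_mem_Ioo ht a))⟩
  · have htendsto := (((h.piecewiseSmooth.1 x hx).mono Set.Ioo_subset_Icc_self).sub_const c).inv₀
      (sub_ne_zero.2 hxc)
    exact (htendsto.isBigO_one ℝ).trans (isBigO_of_le fun t ht =>
      ⟨zero_le_one, one_le_inv_pow_mul_inv_one_sub_pow ht a b⟩)

theorem isBigO_logDeriv (h0 : ∀ t ∈ Set.Ioo (0 : ℝ) 1, γ t ≠ 0) :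
    (fun t => deriv γ t / γ t) =O[𝓟 (Set.Ioo 0 1)] fun t : ℝ => t⁻¹ * (1 - t)⁻¹ := by
  have hinv := h.isBigO_inv_sub h0 (a := 1) (b := 1) (fun _ => one_ne_zero) fun _ => one_ne_zero
  simpa only [sub_zero, pow_one, Pi.one_apply, one_mul, ← div_eq_mul_inv (deriv γ _)] using
    h.piecewiseSmooth.isBigO_deriv.mul hinv

end IsPathFromTo

end Paths

section BetaKernel

/-- The integrand of the beta integral with equal exponents. -/
def betaKernel (ε t : ℝ) : ℝ := t ^ (ε - 1) * (1 - t) ^ (ε - 1)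

variable {ε : ℝ}

theorem integrableOn_betaKernel (hε : 0 < ε) : IntegrableOn (betaKernel ε) (Set.Ioo 0 1) := by
  have h := (Complex.betaIntegral_convergent (u := ε) (v := ε) (by simpa) (by simpa)).norm
  rw [intervalIntegrable_iff_integrableOn_Ioo_of_le zero_le_one] at h
  refine h.congr_fun (fun t ht => ?_) measurableSet_Ioo
  simp only [norm_mul]
  rw [Complex.norm_cpow_eq_rpow_re_of_pos ht.1, show (1 : ℂ) - t = (1 - t : ℝ) by simp,
    Complex.norm_cpow_eq_rpow_re_of_pos (sub_pos.2 ht.2)]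
  simp [betaKernel]

theorem betaKernel_nonneg {t : ℝ} (ht : t ∈ Set.Ioo (0 : ℝ) 1) : 0 ≤ betaKernel ε t :=
  mul_nonneg (Real.rpow_nonneg ht.1.le _) (Real.rpow_nonneg (sub_nonneg.2 ht.2.le) _)

theorem integrableOn_prod_betaKernel {V : Type*} [Fintype V] (hε : 0 < ε) :
    IntegrableOn (fun s : V → ℝ => ∏ v, betaKernel ε (s v))
      (Set.univ.pi fun _ => Set.Ioo 0 1) := by
  rw [IntegrableOn, volume_pi, Measure.restrict_pi_pi]
  exact .fintype_prod fun _ => integrableOn_betaKernel hε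

theorem inv_le_rpow_neg_mul_rpow_sub_one {a b : ℝ} (ha : 0 < a) (hab : a ≤ b) (hε : 0 ≤ ε) :
    b⁻¹ ≤ a ^ (-ε) * b ^ (ε - 1) := by
  have hb : 0 < b := ha.trans_le hab
  calc
    b⁻¹ = b ^ (-ε) * b ^ (ε - 1) := by
        rw [← Real.rpow_add hb, ← Real.rpow_neg_one]
        ring_nf
    _ ≤ a ^ (-ε) * b ^ (ε - 1) :=
        mul_le_mul_of_nonneg_right (Real.rpow_le_rpow_of_nonpos ha hab (neg_nonpos.2 hε))
          (by positivity)

theorem inv_mul_inv_one_sub_le_betaKernel {a t b : ℝ} (ha : 0 < a) (hat : a ≤ t) (htb : t ≤ b)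
    (hb : b < 1) (hε : 0 ≤ ε) :
    t⁻¹ * (1 - t)⁻¹ ≤ a ^ (-ε) * (1 - b) ^ (-ε) * betaKernel ε t := by
  have ht : 0 < t := ha.trans_le hat
  have hb' : 0 < 1 - b := sub_pos.2 hb
  have ht' : 0 < 1 - t := sub_pos.2 (htb.trans_lt hb)
  rw [betaKernel, mul_mul_mul_comm]
  exact mul_le_mul (inv_le_rpow_neg_mul_rpow_sub_one ha hat hε)
    (inv_le_rpow_neg_mul_rpow_sub_one hb' (sub_le_sub_left htb 1) hε) (by positivity)
    (by positivity)

theorem prod_rpow_neg_mul_inv_pow_le {V : Type*} [Fintype V] [DecidableEq V] {x : V → ℝ}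
    (hx : ∀ v, x v ∈ Set.Ioc (0 : ℝ) 1) {L : Finset V} (hL : ∀ v, ∏ w ∈ L, x w ≤ x v) (σ : V → V)
    (hε : 0 < ε) (hcard : 2 * ε * Fintype.card V = 1 - ε) :
    ∏ v, x (σ v) ^ (-ε) * (x v)⁻¹ ^ (if v ∈ L then 0 else 1) ≤ ∏ v, x v ^ (ε - 1) := by
  -- Every coordinate is at least `μ`, so each factor costs at most `μ ^ (-2ε)` more than wanted;
  -- the missing factors of the coordinates in `L`, whose product is `μ`, make up for that.
  set μ := ∏ w ∈ L, x w with hμ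
  have hμ_pos : 0 < μ := Finset.prod_pos fun w _ => (hx w).1
  have hμ_le : μ ≤ 1 := Finset.prod_le_one (fun w _ => (hx w).1.le) fun w _ => (hx w).2
  have hfactor (v : V) : x (σ v) ^ (-ε) * (x v)⁻¹ ^ (if v ∈ L then 0 else 1) ≤
      μ ^ (-ε) * μ ^ (-ε) * (if v ∈ L then 1 else x v ^ (ε - 1)) := by
    have hv := (hx v).1
    rw [mul_assoc]
    refine mul_le_mul (Real.rpow_le_rpow_of_nonpos hμ_pos (hL _) (neg_nonpos.2 hε.le)) ?_
      (by positivity) (by positivity)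
    split_ifs
    · simpa using Real.one_le_rpow_of_pos_of_le_one_of_nonpos hμ_pos hμ_le (neg_nonpos.2 hε.le)
    · simpa using inv_le_rpow_neg_mul_rpow_sub_one hμ_pos (hL v) hε.le
  have hμ_pow : (μ ^ (-ε) * μ ^ (-ε)) ^ Fintype.card V = ∏ v ∈ L, x v ^ (ε - 1) := by
    rw [Real.finsetProd_rpow _ _ fun w _ => (hx w).1.le, ← hμ, ← Real.rpow_add hμ_pos,
      ← Real.rpow_mul_natCast hμ_pos.le]
    congr 1
    linarith
  calc ∏ v, x (σ v) ^ (-ε) * (x v)⁻¹ ^ (if v ∈ L then 0 else 1)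
      ≤ ∏ v, μ ^ (-ε) * μ ^ (-ε) * (if v ∈ L then 1 else x v ^ (ε - 1)) :=
        Finset.prod_le_prod (fun v _ => by have := (hx v).1; have := (hx (σ v)).1; positivity)
          fun v _ => hfactor v
    _ = (∏ v, if v ∈ L then x v ^ (ε - 1) else 1) * ∏ v, if v ∈ L then 1 else x v ^ (ε - 1) := by
        rw [Finset.prod_mul_distrib, Finset.prod_const, Finset.card_univ, hμ_pow,
          Finset.prod_ite_mem, Finset.univ_inter]
    _ = ∏ v, x v ^ (ε - 1) := by
        rw [← Finset.prod_mul_distrib]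
        exact Finset.prod_congr rfl fun v _ => by split_ifs <;> simp

end BetaKernel

namespace IsPathFromTo

variable {γ : ℝ → ℂ} {p q : TangentialBasePoint} {M : Set ℂ} (h : IsPathFromTo γ p q M)
include h

theorem isBigO_logDiff (h0 : ∀ t ∈ Set.Ioo (0 : ℝ) 1, γ t ≠ 0) {ε : ℝ} (hε : 0 < ε) :
    (fun x : ℝ × ℝ => logDiff γ x.1 x.2) =O[𝓟 {x | 0 < x.1 ∧ x.1 ≤ x.2 ∧ x.2 < 1}]
      fun x => x.1 ^ (-ε) * (1 - x.2) ^ (-ε) := by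
  obtain ⟨C, hC0, hC⟩ := (h.isBigO_logDeriv h0).exists_nonneg
  rw [Asymptotics.isBigOWith_principal] at hC
  refine .of_bound (C * ∫ u in Set.Ioo (0 : ℝ) 1, betaKernel ε u) ?_
  rintro ⟨a, b⟩ ⟨ha, hab, hb⟩
  have : 0 < 1 - b := sub_pos.2 hb
  have hsub : Set.Ioc a b ⊆ Set.Ioo 0 1 := fun u hu => ⟨ha.trans hu.1, hu.2.trans_lt hb⟩
  have hint := integrableOn_betaKernel hε
  have hbound (u : ℝ) (hu : u ∈ Set.Ioc a b) :
      ‖deriv γ u / γ u‖ ≤ C * (a ^ (-ε) * (1 - b) ^ (-ε)) * betaKernel ε u := by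
    have hu' : 0 ≤ u⁻¹ * (1 - u)⁻¹ :=
      mul_nonneg (inv_nonneg.2 (hsub hu).1.le) (inv_nonneg.2 (sub_nonneg.2 (hsub hu).2.le))
    refine (hC u (hsub hu)).trans ?_
    rw [Real.norm_of_nonneg hu', mul_assoc]
    exact mul_le_mul_of_nonneg_left
      (inv_mul_inv_one_sub_le_betaKernel ha hu.1.le hu.2 hb hε.le) hC0
  calc ‖∫ u in a..b, deriv γ u / γ u‖
      ≤ ∫ u in a..b, C * (a ^ (-ε) * (1 - b) ^ (-ε)) * betaKernel ε u :=
        intervalIntegral.norm_integral_le_of_norm_le hab (ae_of_all _ hbound)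
          ((intervalIntegrable_iff_integrableOn_Ioc_of_le hab).2
            ((hint.mono_set hsub).const_mul _))
    _ = C * (a ^ (-ε) * (1 - b) ^ (-ε)) * ∫ u in Set.Ioc a b, betaKernel ε u := by
        rw [intervalIntegral.integral_const_mul, intervalIntegral.integral_of_le hab]
    _ ≤ C * (a ^ (-ε) * (1 - b) ^ (-ε)) * ∫ u in Set.Ioo (0 : ℝ) 1, betaKernel ε u :=
        mul_le_mul_of_nonneg_left (setIntegral_mono_set hint
          (ae_restrict_of_forall_mem measurableSet_Ioo fun u hu => betaKernel_nonneg hu)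
          hsub.eventuallyLE) (by positivity)
    _ = (C * ∫ u in Set.Ioo (0 : ℝ) 1, betaKernel ε u) * ‖a ^ (-ε) * (1 - b) ^ (-ε)‖ := by
        rw [Real.norm_of_nonneg (by positivity), mul_right_comm]

theorem isBigO_logDiff_pow (h0 : ∀ t ∈ Set.Ioo (0 : ℝ) 1, γ t ≠ 0) {ε : ℝ} (hε : 0 < ε) (n : ℕ) :
    (fun x : ℝ × ℝ => logDiff γ x.1 x.2 ^ n) =O[𝓟 {x | 0 < x.1 ∧ x.1 ≤ x.2 ∧ x.2 < 1}]
      fun x => x.1 ^ (-ε) * (1 - x.2) ^ (-ε) := by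
  have rpow_pow_le {a : ℝ} (ha : 0 < a) (ha' : a ≤ 1) : (a ^ (-(ε / (n + 1)))) ^ n ≤ a ^ (-ε) := by
    rw [← Real.rpow_mul_natCast ha.le]
    refine Real.rpow_le_rpow_of_exponent_ge ha ha' ?_
    rw [neg_mul, neg_le_neg_iff, div_mul_eq_mul_div, div_le_iff₀ (by positivity)]
    linarith
  refine ((h.isBigO_logDiff h0 (div_pos hε n.cast_add_one_pos)).pow n).trans
    (.of_norm_eventuallyLE ?_)
  rintro ⟨a, b⟩ ⟨ha, hab, hb⟩
  have hb' : 0 < 1 - b := sub_pos.2 hb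
  refine (Real.norm_of_nonneg (by positivity)).trans_le ?_
  rw [mul_pow]
  exact mul_le_mul (rpow_pow_le ha (hab.trans hb.le)) (rpow_pow_le hb' (by linarith))
    (by positivity) (by positivity)

variable {r : ℕ} {c : LaurentPoly r} (hc : ∀ t ∈ Set.Ioo (0 : ℝ) 1, c ≠ LaurentPoly.const r (γ t))
include hc

theorem isBigO_pole {a b : ℕ} (ha : c = LaurentPoly.const r (γ 0) → a ≠ 0)
    (hb : c = LaurentPoly.const r (γ 1) → b ≠ 0) :
    (fun t => pole c (γ t)) =O[𝓟 (Set.Ioo 0 1)] fun t : ℝ => t⁻¹ ^ a * (1 - t)⁻¹ ^ b := by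
  by_cases hconst : ∃ w, c = LaurentPoly.const r w
  · obtain ⟨w, rfl⟩ := hconst
    simp only [pole_const]
    exact h.isBigO_inv_sub (fun t ht e => hc t ht (e ▸ rfl)) (fun e => ha (e ▸ rfl))
      fun e => hb (e ▸ rfl)
  · simp only [pole_of_ne_const (not_exists.1 hconst)]
    refine .of_norm_eventuallyLE fun t ht => ?_
    exact norm_one.trans_le (one_le_inv_pow_mul_inv_one_sub_pow ht a b)

theorem continuousOn_pole : ContinuousOn (fun t => pole c (γ t)) (Set.Ioo 0 1) := by
  by_cases hconst : ∃ w, c = LaurentPoly.const r w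
  · obtain ⟨w, rfl⟩ := hconst
    simp only [pole_const]
    exact ((h.piecewiseSmooth.1.mono Set.Ioo_subset_Icc_self).sub continuousOn_const).inv₀
      fun t ht => sub_ne_zero.2 fun e => hc t ht (e ▸ rfl)
  · simp only [pole_of_ne_const (not_exists.1 hconst)]
    exact continuousOn_const

end IsPathFromTo

theorem IsPathFromTo.ne_zero {r : ℕ} {D : Set (LaurentPoly r)} {γ : ℝ → ℂ}
    {p q : TangentialBasePoint} (h : IsPathFromTo γ p q (complexCompl (insert 0 D))) (t : ℝ)
    (ht : t ∈ Set.Ioo (0 : ℝ) 1) : γ t ≠ 0 :=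
  fun e => h.mem t ht (Or.inl (LaurentPoly.const_eq_zero.2 e))

namespace PosTree

variable {r : ℕ} {V : Type*} (N : PosTree r V)

section Domain

variable {N} {s : V → ℝ} (hs : s ∈ N.domain)
include hs

theorem le_parent (v : V) : s v ≤ s (N.parent v) := by
  by_cases hv : v = N.root
  · rw [hv, N.parent_root]
  · exact (hs.2 v hv).le

theorem le_root (v : V) : s v ≤ s N.root :=
  N.induction (P := fun v => s v ≤ s N.root) le_rfl (fun w _ hw => (le_parent hs w).trans hw) v

end Domain

variable [Fintype V]

open Classical in
/-- The vertices without children; unlike in a graph, the root is a leaf only if it is the only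
vertex. -/
def leaves : Finset V := {v | N.children v = ∅}

variable {N} in
theorem prod_leaves_le {s : V → ℝ} (hs : s ∈ N.domain) (v : V) : ∏ w ∈ N.leaves, s w ≤ s v := by
  classical
  have : Nonempty V := ⟨v⟩
  obtain ⟨w, hw⟩ := Finite.exists_min s
  have hleaf : w ∈ N.leaves := Finset.mem_filter_univ _ |>.2 <|
    Set.eq_empty_of_forall_notMem fun x ⟨hx, hxw⟩ => (hw x).not_gt (hxw ▸ hs.2 x hx)
  rw [← Finset.mul_prod_erase _ _ hleaf]
  exact (mul_le_of_le_one_right (hs.1 w).1.le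
    (Finset.prod_le_one (fun x _ => (hs.1 x).1.le) fun x _ => (hs.1 x).2.le)).trans (hw v)

open Classical in
/-- The order of magnitude of the factor of `v` in the integrand, with small exponents `-ε` for the
power of the logarithm. -/
def magnitude (ε : ℝ) (s : V → ℝ) (v : V) : ℝ :=
  (s v ^ (-ε) * (1 - s (N.parent v)) ^ (-ε)) *
    ((s v)⁻¹ ^ (if v ∈ N.leaves then 0 else 1) * (1 - s v)⁻¹ ^ (if v = N.root then 0 else 1))

variable {N} in
theorem magnitude_nonneg {s : V → ℝ} (hs : s ∈ N.domain) (ε : ℝ) (v : V) :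
    0 ≤ N.magnitude ε s v := by
  have := (hs.1 v).1
  have := sub_pos.2 (hs.1 v).2
  have := sub_pos.2 (hs.1 (N.parent v)).2
  rw [magnitude]
  positivity

variable {N} in
theorem prod_magnitude_le {s : V → ℝ} (hs : s ∈ N.domain) {ε : ℝ} (hε : 0 < ε)
    (hcard : 2 * ε * Fintype.card V = 1 - ε) :
    ∏ v, N.magnitude ε s v ≤ ∏ v, betaKernel ε (s v) := by
  classical
  have hs_pos (v : V) : 0 < s v := (hs.1 v).1
  have hs_one (v : V) : 0 < 1 - s v := sub_pos.2 (hs.1 v).2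
  have hleaves := prod_rpow_neg_mul_inv_pow_le (fun v => ⟨hs_pos v, (hs.1 v).2.le⟩)
    (prod_leaves_le hs) id hε hcard
  have hroot := prod_rpow_neg_mul_inv_pow_le (x := fun v => 1 - s v) (L := {N.root})
    (fun v => ⟨hs_one v, sub_le_self 1 (hs_pos v).le⟩)
    (fun v => by
      rw [Finset.prod_singleton]
      exact sub_le_sub_left (le_root hs v) 1)
    N.parent hε hcard
  simp only [Finset.mem_singleton, id] at hleaves hroot
  simp only [magnitude, betaKernel, mul_mul_mul_comm _ ((1 - s _) ^ (-ε)), Finset.prod_mul_distrib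
    (f := fun v => s v ^ (-ε) * _), Finset.prod_mul_distrib (f := fun v => s v ^ (ε - 1))]
  refine mul_le_mul hleaves hroot (Finset.prod_nonneg fun v _ => ?_)
    (Finset.prod_nonneg fun v _ => Real.rpow_nonneg (hs_pos v).le _)
  have := hs_one v
  have := hs_one (N.parent v)
  positivity

section Factor

variable {D : Set (LaurentPoly r)} {γ : ℝ → ℂ} {p q : TangentialBasePoint}

omit [Fintype V] in
theorem continuousOn_logPower (hγ : PiecewiseSmooth γ) (h0 : ∀ t ∈ Set.Ioo (0 : ℝ) 1, γ t ≠ 0)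
    (v : V) : ContinuousOn (fun s => N.logPower γ s v) N.domain := by
  have hhalf : (1 / 2 : ℝ) ∈ Set.Ioo (0 : ℝ) 1 := by norm_num
  have hcont (w : V) : ContinuousOn (fun s : V → ℝ => logDiff γ (1 / 2) (s w)) N.domain :=
    (continuousOn_logDiff hγ h0 hhalf).comp (continuous_apply w).continuousOn fun s hs => hs.1 w
  have hdiff := (hcont (N.parent v)).fun_sub (hcont v)
  refine ((continuousOn_const (c := ((N.idx v - 1).factorial : ℂ)⁻¹)).fun_mul
    (hdiff.fun_pow (N.idx v - 1))).congr fun s hs => ?_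
  simp only [logPower, ← logDiff_add_logDiff hγ h0 hhalf (hs.1 v) (hs.1 (N.parent v)),
    add_sub_cancel_left]

/-- The factor of the vertex `v` in the integrand, up to functions that extend continuously to the
cube. -/
def singularFactor (γ : ℝ → ℂ) (s : V → ℝ) (v : V) : ℂ :=
  N.logPower γ s v * deriv γ (s v) * pole (N.color v) (γ (s v))

variable {N} (hN : N.Admissible D γ) (h : IsPathFromTo γ p q (complexCompl (insert 0 D)))

include hN h

omit [Fintype V] in
theorem Admissible.color_ne_const (v : V) (t : ℝ) (ht : t ∈ Set.Ioo (0 : ℝ) 1) :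
    N.color v ≠ LaurentPoly.const r (γ t) :=
  fun e => h.mem t ht (e ▸ hN.color_mem v)

theorem Admissible.aestronglyMeasurable_singularFactor (v : V) :
    AEStronglyMeasurable (fun s => N.singularFactor γ s v) (volume.restrict N.domain) := by
  have hlog := N.continuousOn_logPower h.piecewiseSmooth h.ne_zero v
  have hpole : ContinuousOn (fun s : V → ℝ => pole (N.color v) (γ (s v))) N.domain :=
    (h.continuousOn_pole (hN.color_ne_const h v)).comp (continuous_apply v).continuousOn
      fun s hs => hs.1 v
  have hderiv : Measurable fun s : V → ℝ => deriv γ (s v) :=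
    (measurable_deriv γ).comp (measurable_pi_apply v)
  exact ((hlog.aestronglyMeasurable N.measurableSet_domain).mul hderiv.aestronglyMeasurable).mul
    (hpole.aestronglyMeasurable N.measurableSet_domain)

theorem Admissible.isBigO_singularFactor {ε : ℝ} (hε : 0 < ε) (v : V) :
    (fun s => N.singularFactor γ s v) =O[𝓟 N.domain] fun s => N.magnitude ε s v := by
  classical
  have hcoord : Tendsto (fun s : V → ℝ => s v) (𝓟 N.domain) (𝓟 (Set.Ioo 0 1)) :=
    tendsto_principal_principal.2 fun s hs => hs.1 v
  have hedge : Tendsto (fun s : V → ℝ => (s v, s (N.parent v))) (𝓟 N.domain)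
      (𝓟 {x | 0 < x.1 ∧ x.1 ≤ x.2 ∧ x.2 < 1}) :=
    tendsto_principal_principal.2 fun s hs =>
      ⟨(hs.1 v).1, le_parent hs v, (hs.1 (N.parent v)).2⟩
  have hlog := ((h.isBigO_logDiff_pow h.ne_zero hε (N.idx v - 1)).const_mul_left
    ((N.idx v - 1).factorial : ℂ)⁻¹).comp_tendsto hedge
  have hderiv := h.piecewiseSmooth.isBigO_deriv.comp_tendsto hcoord
  have hpole := (h.isBigO_pole (hN.color_ne_const h v)
    (a := if v ∈ N.leaves then 0 else 1) (b := if v = N.root then 0 else 1)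
    (fun e => by simpa [leaves] using fun hv => hN.leaf v hv e)
    fun e => by simpa using fun hv : v = N.root => hN.root_ne_target (hv ▸ e)).comp_tendsto hcoord
  refine ((hlog.mul hderiv).mul hpole).congr' ?_ ?_
  · exact .rfl
  · refine .of_forall fun s => ?_
    simp [magnitude]

end Factor

section Convergence

variable {Γ : Type} [AddCommGroup Γ] [LinearOrder Γ] [IsOrderedAddMonoid Γ]
  (mon : (Fin r → ℤ) ≃+ Γ) {γ : ℝ → ℂ}

theorem exists_integrand_eq (hγ : ContinuousOn γ (Set.Icc 0 1))
    (hreg : ∀ v, (∀ c, N.color v ≠ LaurentPoly.const r c) → RegularAlong mon γ (N.color v))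
    (m : Fin r → ℤ) : ∃ q : BoundedContinuousFunction (V → ℝ) ℂ, ∀ s ∈ N.domain,
      N.integrand mon γ m s = (∏ v, N.singularFactor γ s v) * q s := by
  obtain ⟨q, hq⟩ := exists_coeff_prod_fraction_eq mon
    (⟨fun t => γ t, hγ.domRestrict⟩ : C(Set.Icc (0 : ℝ) 1, ℂ)) N.color
    (fun v hv => (hreg v hv).imp_right fun h t => h t t.2) (mon m)
  let proj : C(V → ℝ, V → Set.Icc (0 : ℝ) 1) :=
    ⟨fun s v => Set.projIcc 0 1 zero_le_one (s v), by fun_prop⟩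
  refine ⟨(BoundedContinuousFunction.mkOfCompact q).compContinuous proj, fun s hs => ?_⟩
  have hproj (v : V) : (proj s v : ℝ) = s v :=
    congrArg Subtype.val (Set.projIcc_of_mem zero_le_one (Set.Ioo_subset_Icc_self (hs.1 v)))
  have hcoeff : (∏ v, fraction mon (γ (proj s v)) (N.color v)).coeff (mon m) =
      (∏ v, pole (N.color v) (γ (proj s v))) * q (proj s) := hq (proj s)
  simp only [hproj] at hcoeff
  rw [integrand, hcoeff, ← mul_assoc, ← Finset.prod_mul_distrib]
  rfl

variable {N} {D : Set (LaurentPoly r)} {p q : TangentialBasePoint}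

theorem Admissible.converges (hN : N.Admissible D γ)
    (h : IsPathFromTo γ p q (complexCompl (insert 0 D)))
    (hreg : ∀ a ∈ D, (∀ c, a ≠ LaurentPoly.const r c) → RegularAlong mon γ a) :
    N.Converges mon γ := by
  intro m
  obtain ⟨f, hf⟩ := N.exists_integrand_eq mon h.piecewiseSmooth.1 (fun v hv =>
    hreg _ ((hN.color_mem v).resolve_left fun e => hv 0 (e.trans (map_zero _).symm)) hv) m
  obtain ⟨ε, hε, hcard⟩ : ∃ ε : ℝ, 0 < ε ∧ 2 * ε * Fintype.card V = 1 - ε :=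
    ⟨1 / (2 * Fintype.card V + 1), by positivity, by field_simp; ring⟩
  have hmeas := N.measurableSet_domain
  have := principal_isMeasurablyGenerated_iff.2 hmeas
  have hbound : (fun s => (∏ v, N.singularFactor γ s v) * f s) =O[𝓟 N.domain]
      fun s => ∏ v, betaKernel ε (s v) := by
    have hprod : (fun s => ∏ v, N.singularFactor γ s v) =O[𝓟 N.domain]
        fun s => ∏ v, N.magnitude ε s v :=
      .finsetProd fun v _ => hN.isBigO_singularFactor h hε v
    have hmagnitude : (fun s => ∏ v, N.magnitude ε s v) =O[𝓟 N.domain]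
        fun s => ∏ v, betaKernel ε (s v) :=
      .of_norm_eventuallyLE fun s hs => (Real.norm_of_nonneg
        (Finset.prod_nonneg fun v _ => magnitude_nonneg hs ε v)).trans_le
          (prod_magnitude_le hs hε hcard)
    have hf_one : (fun s => f s) =O[𝓟 N.domain] (1 : (V → ℝ) → ℝ) :=
      .of_bound ‖f‖ (.of_forall fun s => by simpa using f.norm_coe_le_norm (x := s))
    simpa only [Pi.one_apply, mul_one] using (hprod.trans hmagnitude).mul hf_one
  have hmeasurable := (Finset.aestronglyMeasurable_fun_prod Finset.univ fun v _ =>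
    hN.aestronglyMeasurable_singularFactor h v).mul f.continuous.aestronglyMeasurable
  have hintegrable : IntegrableOn (fun s => ∏ v, betaKernel ε (s v)) N.domain :=
    (integrableOn_prod_betaKernel hε).mono_set fun s hs v _ => hs.1 v
  obtain ⟨t, ht, hint⟩ := hbound.integrableAtFilter ⟨_, mem_principal_self _, hmeasurable⟩
    ⟨_, mem_principal_self _, hintegrable⟩
  exact (hint.mono_set ht).congr_fun (fun s hs => (hf s hs).symm) hmeas

end Convergence

end PosTree

namespace ParentMap

variable {V : Type*} {T : ParentMap V} {v w : V} (hv : v ≠ T.root)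

section OneChild

variable (hw : T.children v = {w})
include hw

theorem ne_root_of_children_eq : w ≠ T.root :=
  (Set.singleton_subset_iff.1 hw.ge).1

theorem parent_of_children_eq : T.parent w = v :=
  (Set.singleton_subset_iff.1 hw.ge).2

include hv

theorem ne_of_children_eq : w ≠ v := by
  rintro rfl
  exact parent_ne hv (parent_of_children_eq hw)

theorem parent_eq_iff_of_children_eq {x : V} : T.parent x = v ↔ x = w := by
  refine ⟨fun h => ?_, fun h => h ▸ parent_of_children_eq hw⟩
  have hx : x ∈ T.children v := ⟨fun e => hv (by rw [← h, e, T.parent_root]), h⟩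
  rwa [hw] at hx

end OneChild

variable [DecidableEq V]

variable (T) in
/-- The tree without the vertex `v`, whose children become children of its parent. -/
def contract : ParentMap {x : V // x ≠ v} where
  root := ⟨T.root, hv.symm⟩
  parent x := ⟨if T.parent x = v then T.parent v else T.parent x, by
    split_ifs with h
    exacts [parent_ne hv, h]⟩
  parent_root := Subtype.ext <| by
    simp only [T.parent_root, if_neg hv.symm]
  exists_height := by
    obtain ⟨h, hh⟩ := T.exists_height
    refine ⟨fun x => h x, fun x hx => ?_⟩
    have hx' : h (T.parent x) < h x := hh x fun e => hx (Subtype.ext e)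
    dsimp only
    split_ifs with hp
    exacts [((hh v hv).trans_eq (congrArg h hp.symm)).trans hx', hx']

theorem image_children_contract (hw : T.children v = {w}) (x : {x : V // x ≠ v}) :
    Subtype.val '' (T.contract hv).children x = Equiv.swap v w '' T.children x := by
  have hmem (y : {x : V // x ≠ v}) : y ∈ (T.contract hv).children x ↔
      y.1 ≠ T.root ∧ (if y.1 = w then T.parent v else T.parent y) = x := by
    simp only [children, contract, Set.mem_ofPred_eq, ne_eq, Subtype.ext_iff,
      parent_eq_iff_of_children_eq hv hw]
  ext z
  rw [Set.mem_image, (Equiv.swap v w).image_eq_preimage_symm, Set.mem_preimage, Equiv.symm_swap]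
  simp only [hmem, Subtype.exists, exists_and_right, exists_eq_right]
  have hwv := ne_of_children_eq hv hw
  rcases eq_or_ne z v with rfl | hzv
  · have hwx : T.parent w ≠ x := fun e => x.2 (e.symm.trans (parent_of_children_eq hw))
    simp [children, hwx]
  · rcases eq_or_ne z w with rfl | hzw
    · simp [children, hwv, hv, ne_root_of_children_eq hw]
    · simp [children, hzv, hzw, Equiv.swap_apply_of_ne_of_ne]

end ParentMap

/-- The coordinate at `v` together with all other coordinates. -/
def splitCoordinate {V : Type*} [DecidableEq V] (v : V) :
    (V → ℝ) ≃ᵐ ℝ × ({x : V // x ≠ v} → ℝ) :=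
  (MeasurableEquiv.piEquivPiSubtypeProd (fun _ => ℝ) (· = v)).trans
    ((MeasurableEquiv.piUnique fun _ : {x : V // x = v} => ℝ).prodCongr (.refl _))

theorem measurePreserving_splitCoordinate {V : Type*} [DecidableEq V] [Fintype V] (v : V) :
    MeasurePreserving (splitCoordinate v) :=
  -- Instance search would find `Fintype.subtypeEq`, which is not the instance on the other side.
  ((@volume_preserving_piUnique {x : V // x = v} (Subtype.fintype _) (fun _ => ℝ) _ _).prod
    (.id volume)).comp (volume_preserving_piEquivPiSubtypeProd (fun _ => ℝ) (· = v))

theorem splitCoordinate_symm_self {V : Type*} [DecidableEq V] (v : V)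
    (z : ℝ × ({x : V // x ≠ v} → ℝ)) : (splitCoordinate v).symm z v = z.1 :=
  congrArg Prod.fst ((splitCoordinate v).apply_symm_apply z)

theorem splitCoordinate_symm_coe {V : Type*} [DecidableEq V] {v : V}
    (z : ℝ × ({x : V // x ≠ v} → ℝ)) (x : {x : V // x ≠ v}) :
    (splitCoordinate v).symm z x = z.2 x :=
  congrFun (congrArg Prod.snd ((splitCoordinate v).apply_symm_apply z)) x

namespace PosTree

variable {r : ℕ} {V : Type*} [DecidableEq V] (N : PosTree r V) {v w : V} (hv : v ≠ N.root)

/-- The tree without the vertex `v`, whose index is added to the indices of its children. -/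
def contract : PosTree r {x : V // x ≠ v} where
  toParentMap := N.toParentMap.contract hv
  color x := N.color x
  idx x := if N.parent x = v then N.idx v + N.idx x else N.idx x
  idx_root := by
    have hroot : (N.toParentMap.contract hv).root.1 = N.root := rfl
    rw [hroot, N.parent_root, if_neg hv.symm, N.idx_root]
  idx_pos x := by
    have := N.idx_pos x
    split_ifs <;> omega

variable {N} {D : Set (LaurentPoly r)} {γ : ℝ → ℂ}

theorem Admissible.contract (hN : N.Admissible D γ) (hw : N.children v = {w}) :
    (N.contract hv).Admissible D γ where
  color_mem x := hN.color_mem x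
  leaf x hx := hN.leaf x (Set.image_eq_empty.1
    ((ParentMap.image_children_contract hv hw x).symm.trans (Set.image_eq_empty.2 hx)))
  root_ne_source := hN.root_ne_source
  root_ne_target := hN.root_ne_target
  root_zero hzero := by
    have himage := congrArg Set.ncard
      (ParentMap.image_children_contract hv hw (N.contract hv).root)
    rw [Set.ncard_image_of_injective _ Subtype.val_injective,
      Set.ncard_image_of_injective _ (Equiv.injective _)] at himage
    exact himage.trans (hN.root_zero hzero)
  root_child hzero := Set.image_nonempty.1
    (ParentMap.image_children_contract hv hw (N.contract hv).root ▸
      (hN.root_child hzero).image _)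

variable (hw : N.children v = {w})
include hw

theorem mem_domain_iff_contract (s : V → ℝ) :
    s ∈ N.domain ↔ (fun x : {x : V // x ≠ v} => s x) ∈ (N.contract hv).domain ∧
      s v ∈ Set.Ioo (s w) (s (N.parent v)) := by
  have hparent (x : V) (hx : x ≠ w) : N.parent x ≠ v :=
    mt (ParentMap.parent_eq_iff_of_children_eq hv hw).1 hx
  have hw_root := ParentMap.ne_root_of_children_eq hw
  have hw_parent := ParentMap.parent_of_children_eq hw
  have hcontract : (fun x : {x : V // x ≠ v} => s x) ∈ (N.contract hv).domain ↔
      (∀ x, x ≠ v → s x ∈ Set.Ioo (0 : ℝ) 1) ∧ ∀ x, x ≠ v → x ≠ N.root →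
        s x < s (if N.parent x = v then N.parent v else N.parent x) := by
    simp only [domain, contract, ParentMap.contract, Set.mem_ofPred_eq, ne_eq, Subtype.ext_iff,
      Subtype.forall]
  rw [hcontract]
  constructor
  · rintro ⟨hcube, hlt⟩
    have hwv : s w < s v := hw_parent ▸ hlt w hw_root
    refine ⟨⟨fun x _ => hcube x, fun x _ hx => ?_⟩, hwv, hlt v hv⟩
    split_ifs with h
    exacts [((hlt x hx).trans_eq (congrArg s h)).trans (hlt v hv), hlt x hx]
  · rintro ⟨⟨hcube, hlt⟩, hwv, hvp⟩
    refine ⟨fun x => ?_, fun x hx => ?_⟩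
    · rcases eq_or_ne x v with rfl | hxv
      · exact ⟨(hcube w (ParentMap.ne_of_children_eq hv hw)).1.trans hwv,
          hvp.trans (hcube _ (ParentMap.parent_ne hv)).2⟩
      · exact hcube x hxv
    · rcases eq_or_ne x v with rfl | hxv
      · exact hvp
      · rcases eq_or_ne x w with rfl | hxw
        · rwa [hw_parent]
        · exact (hlt x hxv hx).trans_eq (by rw [if_neg (hparent x hxw)])

theorem logPower_contract_of_ne (s : V → ℝ) {x : {x : V // x ≠ v}} (hx : x.1 ≠ w) :
    (N.contract hv).logPower γ (fun x => s x) x = N.logPower γ s x := by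
  simp only [logPower, contract, ParentMap.contract,
    if_neg (mt (ParentMap.parent_eq_iff_of_children_eq hv hw).1 hx)]

theorem logPower_contract (y : {x : V // x ≠ v} → ℝ) :
    (N.contract hv).logPower γ y ⟨w, ParentMap.ne_of_children_eq hv hw⟩ =
      ((N.idx v - 1 + (N.idx w - 1) + 1).factorial : ℂ)⁻¹ *
        logDiff γ (y ⟨w, ParentMap.ne_of_children_eq hv hw⟩)
          (y ⟨N.parent v, ParentMap.parent_ne hv⟩) ^ (N.idx v - 1 + (N.idx w - 1) + 1) := by
  have hidx : N.idx v + N.idx w - 1 = N.idx v - 1 + (N.idx w - 1) + 1 := by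
    have := N.idx_pos v
    have := N.idx_pos w
    omega
  simp only [logPower, contract, ParentMap.contract, if_pos (ParentMap.parent_of_children_eq hw),
    hidx]

variable {Γ : Type} [AddCommGroup Γ] [LinearOrder Γ] [IsOrderedAddMonoid Γ] [Fintype V]
  (mon : (Fin r → ℤ) ≃+ Γ) (hzero : N.color v = 0)
include hzero

theorem exists_integrand_contract (m : Fin r → ℤ) :
    ∃ R : ({x : V // x ≠ v} → ℝ) → ℂ,
      (∀ y, (N.contract hv).integrand mon γ m y =
        (N.contract hv).logPower γ y ⟨w, ParentMap.ne_of_children_eq hv hw⟩ * R y) ∧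
      ∀ s, N.integrand mon γ m s =
        N.logPower γ s v * N.logPower γ s w * (deriv γ (s v) / γ (s v)) * R fun x => s x := by
  let child : {x : V // x ≠ v} := ⟨w, ParentMap.ne_of_children_eq hv hw⟩
  refine ⟨fun y => (∏ x ∈ {child}ᶜ, (N.contract hv).logPower γ y x) * (∏ x, deriv γ (y x)) *
    (∏ x, fraction mon (γ (y x)) ((N.contract hv).color x)).coeff (mon m), fun y => ?_,
    fun s => ?_⟩
  · rw [integrand, Finset.prod_mul_distrib, Fintype.prod_eq_mul_prod_compl child]
    ring
  · have hsplit {A : Type} [CommMonoid A] (f : V → A) :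
        ∏ x, f x = f v * ∏ x : {x : V // x ≠ v}, f x := by
      rw [Fintype.prod_eq_mul_prod_compl v, Finset.prod_subtype (p := fun x => x ≠ v) _ (by simp)]
    have hlogPower : ∏ x ∈ {child}ᶜ, (N.contract hv).logPower γ (fun x => s x) x =
        ∏ x ∈ {child}ᶜ, N.logPower γ s x :=
      Finset.prod_congr rfl fun x hx => logPower_contract_of_ne hv hw s fun e =>
        Finset.mem_compl.1 hx (Finset.mem_singleton.2 (Subtype.ext e))
    rw [integrand, Finset.prod_mul_distrib, hsplit (N.logPower γ s), hsplit fun x => deriv γ (s x),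
      hsplit fun x => fraction mon (γ (s x)) (N.color x), hzero, fraction_zero,
      HahnSeries.C_mul_eq_smul, HahnSeries.coeff_smul, smul_eq_mul,
      Fintype.prod_eq_mul_prod_compl child]
    beta_reduce
    rw [hlogPower]
    simp only [contract, child]
    ring

variable (h0 : ∀ t ∈ Set.Ioo (0 : ℝ) 1, γ t ≠ 0) (hγ : PiecewiseSmooth γ)
include h0 hγ

theorem integral_indicator_integrand_splitCoordinate (m : Fin r → ℤ)
    (y : {x : V // x ≠ v} → ℝ) :
    ∫ u, N.domain.indicator (N.integrand mon γ m) ((splitCoordinate v).symm (u, y)) =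
      (N.contract hv).domain.indicator ((N.contract hv).integrand mon γ m) y := by
  set low := y ⟨w, ParentMap.ne_of_children_eq hv hw⟩ with hlow
  set high := y ⟨N.parent v, ParentMap.parent_ne hv⟩ with hhigh
  have hv_coord (u : ℝ) : (splitCoordinate v).symm (u, y) v = u := splitCoordinate_symm_self v _
  have hw_coord (u : ℝ) : (splitCoordinate v).symm (u, y) w = low :=
    splitCoordinate_symm_coe (u, y) ⟨w, ParentMap.ne_of_children_eq hv hw⟩
  have hparent_coord (u : ℝ) : (splitCoordinate v).symm (u, y) (N.parent v) = high :=
    splitCoordinate_symm_coe (u, y) ⟨N.parent v, ParentMap.parent_ne hv⟩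
  have hmem (u : ℝ) : (splitCoordinate v).symm (u, y) ∈ N.domain ↔
      y ∈ (N.contract hv).domain ∧ u ∈ Set.Ioo low high := by
    simp only [mem_domain_iff_contract hv hw, splitCoordinate_symm_coe, hv_coord, hw_coord,
      hparent_coord]
  by_cases hy : y ∈ (N.contract hv).domain
  · obtain ⟨R, hcontract, hR⟩ := exists_integrand_contract hv hw mon hzero m (γ := γ)
    have hle : low ≤ high := by
      simpa [contract, ParentMap.contract, ParentMap.parent_of_children_eq hw] using
        le_parent hy ⟨w, ParentMap.ne_of_children_eq hv hw⟩
    have hindicator : (fun u => N.domain.indicator (N.integrand mon γ m)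
        ((splitCoordinate v).symm (u, y))) = (Set.Ioo low high).indicator fun u =>
          ((N.idx v - 1).factorial : ℂ)⁻¹ * logDiff γ u high ^ (N.idx v - 1) *
            (((N.idx w - 1).factorial : ℂ)⁻¹ * logDiff γ low u ^ (N.idx w - 1)) *
              (deriv γ u / γ u) * R y := by
      ext u
      classical
      simp only [Set.indicator_apply, hmem, hy, true_and, hR, logPower,
        splitCoordinate_symm_coe, hv_coord, hw_coord, hparent_coord,
        ParentMap.parent_of_children_eq hw]
    rw [Set.indicator_of_mem hy, hcontract, logPower_contract hv hw, ← hlow, ← hhigh,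
      ← integral_logDiff_pow_mul_logDiff_pow hγ h0 (hy.1 _) hle (hy.1 _).2,
      ← intervalIntegral.integral_mul_const, intervalIntegral.integral_of_le hle,
      integral_Ioc_eq_integral_Ioo, ← integral_indicator measurableSet_Ioo, hindicator]
  · simp [hmem, hy]

theorem converges_contract_and_integral_eq (hconv : N.Converges mon γ) :
    (N.contract hv).Converges mon γ ∧ N.integral mon γ = (N.contract hv).integral mon γ := by
  have hsplit := (measurePreserving_splitCoordinate v).symm
  have hintegrable (m : Fin r → ℤ) : Integrable fun z =>
      N.domain.indicator (N.integrand mon γ m) ((splitCoordinate v).symm z) :=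
    hsplit.integrable_comp_of_integrable
      ((integrable_indicator_iff N.measurableSet_domain).2 (hconv m))
  have hinner := integral_indicator_integrand_splitCoordinate hv hw mon hzero h0 hγ
  refine ⟨fun m => ?_, funext fun m => ?_⟩
  · rw [← integrable_indicator_iff (N.contract hv).measurableSet_domain]
    simpa only [hinner] using (hintegrable m).integral_prod_right
  · rw [integral, integral, ← integral_indicator N.measurableSet_domain,
      ← integral_indicator (N.contract hv).measurableSet_domain,
      ← hsplit.integral_comp (splitCoordinate v).symm.measurableEmbedding,
      Measure.volume_eq_prod, integral_prod_symm _ (hintegrable m)]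
    simp only [hinner]

omit [DecidableEq V] hw hzero

theorem Admissible.exists_reduced {V : Type u} [Fintype V] {N : PosTree r V}
    (hN : N.Admissible D γ) (hconv : N.Converges mon γ) :
    ∃ (W : Type u) (_ : Fintype W) (N' : PosTree r W), N'.Admissible D γ ∧ N'.Converges mon γ ∧
      N.integral mon γ = N'.integral mon γ ∧
      ∀ v, v ≠ N'.root → N'.color v = 0 → (N'.children v).ncard ≠ 1 := by
  induction hcard : Fintype.card V using Nat.strong_induction_on generalizing V with
  | _ n ih =>
    classical
    by_cases hreduced : ∀ v, v ≠ N.root → N.color v = 0 → (N.children v).ncard ≠ 1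
    · exact ⟨V, inferInstance, N, hN, hconv, rfl, hreduced⟩
    push Not at hreduced
    obtain ⟨v, hv, hzero, hone⟩ := hreduced
    obtain ⟨w, hw⟩ := Set.ncard_eq_one.1 hone
    obtain ⟨hconv', hintegral⟩ :=
      converges_contract_and_integral_eq hv hw mon hzero h0 hγ hconv
    have hlt : Fintype.card {x : V // x ≠ v} < n :=
      hcard ▸ Fintype.card_subtype_lt (x := v) (not_not.2 rfl)
    obtain ⟨W, hW, N', hN', hconvN', hintegral', hreduced⟩ :=
      ih _ hlt (hN.contract hv hw) hconv' rfl
    exact ⟨W, hW, N', hN', hconvN', hintegral.trans hintegral', hreduced⟩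

end PosTree

end TreeIntegral

end

theorem mainTheorem7_general {r : ℕ} {Γ : Type} [AddCommGroup Γ] [LinearOrder Γ]
    [IsOrderedAddMonoid Γ] (mon : (Fin r → ℤ) ≃+ Γ)
    (D : Set (TreeIntegral.LaurentPoly r))
    (γ : ℝ → ℂ)
    (hγ : TreeIntegral.IsPathOn γ (TreeIntegral.complexCompl (insert 0 D)))
    (hreg : ∀ a ∈ D, (∀ c, a ≠ TreeIntegral.LaurentPoly.const r c) →
      TreeIntegral.RegularAlong mon γ a)
    (X : TreeIntegral.ColoredTree.{u} D) (hX : X.Admissible γ)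
    (k : X.Index) (hk : k.EssentiallyPositive)
    (hroot : X.color X.root = 0 → X.deg X.root = 1 ∧ ∀ w, X.graph.Adj w X.root → 0 < k.at w)
    (hsingle : γ 0 = 0 → Nontrivial X.V)
    (hconv : γ 0 ≠ 0 → ∀ v, X.color v = TreeIntegral.LaurentPoly.const r (γ 0) →
      ∃ w, w ≠ X.root ∧ 0 < k.at w ∧
        TreeIntegral.ColoredTree.carrier k (X.parent w) = TreeIntegral.ColoredTree.carrier k v) :
    TreeIntegral.ColoredTree.Converges mon γ k ∧
    ∃ (Y : TreeIntegral.ColoredTree.{u} (insert 0 D)) (l : Y.Index),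
      TreeIntegral.ColoredTree.Harvestable γ l ∧
      TreeIntegral.ColoredTree.Converges mon γ l ∧
      TreeIntegral.ColoredTree.iteratedIntegral mon γ k =
        TreeIntegral.ColoredTree.iteratedIntegral mon γ l := by
  obtain ⟨p, q, hpath⟩ := hγ
  have h0 := hpath.ne_zero
  have hadm := TreeIntegral.ColoredTree.admissible_contractZero hX hk hroot hsingle hconv
  have hcontracted := hadm.converges mon hpath hreg
  obtain ⟨hconverges, hintegral⟩ :=
    (TreeIntegral.ColoredTree.isContraction_contractZero
      hk).converges_iff_and_iteratedIntegral_eq mon h0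
  obtain ⟨W, _, N, hN, hNconv, hN_integral, hreduced⟩ :=
    hadm.exists_reduced mon h0 hpath.piecewiseSmooth hcontracted
  obtain ⟨Y, l, hl, hlconv, hl_integral⟩ := hN.exists_harvestable hreduced mon h0 hNconv
  exact ⟨hconverges.2 hcontracted, Y, l, hl, hlconv,
    hintegral.trans (hN_integral.trans hl_integral)⟩

theorem mainTheorem7 {r : ℕ} {Γ : Type} [AddCommGroup Γ] [LinearOrder Γ] [IsOrderedAddMonoid Γ]
    (mon : (Fin r → ℤ) ≃+ Γ)
    (D : Set (TreeIntegral.LaurentPoly r)) (hD : D.Finite)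
    (γ : ℝ → ℂ)
    (hγ : TreeIntegral.IsPathOn γ (TreeIntegral.complexCompl (insert 0 D)))
    (hreg : ∀ a ∈ D, (∀ c, a ≠ TreeIntegral.LaurentPoly.const r c) →
      TreeIntegral.RegularAlong mon γ a)
    (X : TreeIntegral.ColoredTree.{u} D) (hX : X.Admissible γ)
    (k : X.Index) (hk : k.EssentiallyPositive)
    (hroot : X.color X.root = 0 → X.deg X.root = 1 ∧ ∀ w, X.graph.Adj w X.root → 0 < k.at w)
    (hsingle : γ 0 = 0 → Nontrivial X.V)
    (hconv : γ 0 ≠ 0 → ∀ v, X.color v = TreeIntegral.LaurentPoly.const r (γ 0) →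
      ∃ w, w ≠ X.root ∧ 0 < k.at w ∧
        TreeIntegral.ColoredTree.carrier k (X.parent w) = TreeIntegral.ColoredTree.carrier k v) :
    TreeIntegral.ColoredTree.Converges mon γ k ∧
    ∃ (Y : TreeIntegral.ColoredTree.{u} (insert 0 D)) (l : Y.Index),
      TreeIntegral.ColoredTree.Harvestable γ l ∧
      TreeIntegral.ColoredTree.Converges mon γ l ∧
      TreeIntegral.ColoredTree.iteratedIntegral mon γ k =
        TreeIntegral.ColoredTree.iteratedIntegral mon γ l := by
  exact mainTheorem7_general mon D γ hγ hreg X hX k hk hroot hsingle hconv
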